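/- Let $S_0$ be a scheme, let $d, n, r$ be positive integers and let $s \in \Gamma(S_0,\mathcal O_{S_0})$. Let $\bar{\mathcal E}_\bullet = (\bar{\mathcal E}_i, f_i, f^i)$ be an $s$-linked chain on $S_0$, that is: $\bar{\mathcal E}_1,\dots,\bar{\mathcal E}_n$ are vector bundles of rank $d$ with morphisms $f_i:\bar{\mathcal E}_i\to\bar{\mathcal E}_{i+1}$ and $f^i:\bar{\mathcal E}_{i+1}\to\bar{\mathcal E}_i$ for $1\le i\le n-1$ such that (I) $f_i\circ f^i = s\cdot\mathrm{id}$ and $f^i\circ f_i = s\cdot\mathrm{id}$ for $1\le i\le n-1$; (II) on the fibers at any point where $s=0$, $\ker f^i=\operatorname{im} f_i$ and $\ker f_i=\operatorname{im} f^i$ for $1\le i\le n-1$; (III) on the fibers at any point where $s=0$, $\operatorname{im} f_i\cap\ker f_{i+1}=0$ and $\operatorname{im} f^{i+1}\cap\ker f^i=0$ for $1\le i\le n-2$. For each $i$ let $G(r,\bar{\mathcal E}_i)$ be the Grassmannian over $S_0$ of rank-$r$ subbundles of $\bar{\mathcal E}_i$, i.e. the $S_0$-scheme, equipped with a universal subbundle,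 which represents the functor sending $T\to S_0$ to the set of rank-$r$ subbundles of the pullback of $\bar{\mathcal E}_i$ to $T$ (a subbundle being a locally free subsheaf with locally free quotient). Let $\operatorname{LG}(r,\bar{\mathcal E}_\bullet)$ be the linked Grassmannian: the closed subscheme of $G(r,\bar{\mathcal E}_1)\times_{S_0}\cdots\times_{S_0}G(r,\bar{\mathcal E}_n)$ of tuples $(\mathcal F_1,\dots,\mathcal F_n)$ with $f_i(\mathcal F_i)\subseteq\mathcal F_{i+1}$ and $f^i(\mathcal F_{i+1})\subseteq\mathcal F_i$ for $1\le i\le n-1$. Let $S=G(r,\bar{\mathcal E}_1)\times_{S_0}G(r,\bar{\mathcal E}_n)$, let $\mathcal E_\bullet$ be the pullback of $\bar{\mathcal E}_\bullet$ to $S$, and let $\mathcal F_1\subseteq\mathcal E_1$ and $\mathcal F_n\subseteq\mathcal E_n$ be the pullbacks of the universal subbundles of the two factors. Let $D\subseteq S$ be the associated linked determinantal locus: the closed subscheme on which, for every $i=1,\dots,n$, the morphism $$\mathcal E_i\to(\mathcal E_1/\mathcal F_1)\oplus(\mathcal E_n/\mathcal F_n)$$ obtained by composing the $f^j$, respectively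 the $f_j$, has rank at most $d-r$. Then the underlying set of $D$ is precisely the set-theoretic image of $\operatorname{LG}(r,\bar{\mathcal E}_\bullet)$ under the projection to the first and last factors $$G(r,\bar{\mathcal E}_1)\times_{S_0}\cdots\times_{S_0}G(r,\bar{\mathcal E}_n)\to S.$$ -/

import Mathlib

open CategoryTheory CategoryTheory.Limits AlgebraicGeometry

universe u

namespace LinkedDet

noncomputable section

/-! ### Vector bundles and subbundles -/

/-- The trivial bundle `𝒪_X ^ d`. -/
def trivialBundle (X : Scheme.{u}) (d : ℕ) : X.Modules :=
  SheafOfModules.free (R := X.ringCatSheaf) (ULift.{u} (Fin d))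

/-- `E` is a vector bundle of rank `d`: it is locally isomorphic to `𝒪 ^ d`. -/
def IsVectorBundle {X : Scheme.{u}} (E : X.Modules) (d : ℕ) : Prop :=
  ∀ x : X, ∃ U : X.Opens, x ∈ U ∧ Nonempty (E.restrict U.ι ≅ trivialBundle (U : Scheme.{u}) d)

/-- `E` is locally free of finite (locally constant) rank. -/
def IsFiniteLocallyFree {X : Scheme.{u}} (E : X.Modules) : Prop :=
  ∀ x : X, ∃ (U : X.Opens) (d : ℕ),
    x ∈ U ∧ Nonempty (E.restrict U.ι ≅ trivialBundle (U : Scheme.{u}) d)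

/-- `ι : F ⟶ E` exhibits `F` as a rank-`r` subbundle of `E`: it is a monomorphism from a
vector bundle of rank `r`, and the quotient `E / F` is locally free of finite rank. -/
structure IsSubbundle {X : Scheme.{u}} {F E : X.Modules} (ι : F ⟶ E) (r : ℕ) : Prop where
  isVectorBundle : IsVectorBundle F r
  mono : Mono ι
  quotient : IsFiniteLocallyFree (cokernel ι)

/-- Let `E` be a module on `S`, let `π : G ⟶ S`, and let `ι : F ⟶ π^* E`. For `g : T ⟶ G` lying
over `p : T ⟶ S`, this is the pullback `g^* F ⟶ g^* π^* E = p^* E` of `ι`. -/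
def pullbackInclusion {S G T : Scheme.{u}} {E : S.Modules} {π : G ⟶ S} {F : G.Modules}
    (ι : F ⟶ (Scheme.Modules.pullback π).obj E) (g : T ⟶ G) (p : T ⟶ S) (h : g ≫ π = p) :
    (Scheme.Modules.pullback g).obj F ⟶ (Scheme.Modules.pullback p).obj E :=
  (Scheme.Modules.pullback g).map ι ≫ (Scheme.Modules.pullbackComp g π).hom.app E ≫
    (Scheme.Modules.pullbackCongr h).hom.app E

/-! ### Grassmannians -/

/-- `π : G ⟶ S`, together with `ι : 𝒰 ⟶ π^* E`, is the Grassmannian `G(r, E)` with its universal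
subbundle: `𝒰` is a rank-`r` subbundle of `π^* E`, and for every `S`-scheme `p : T ⟶ S` and every
rank-`r` subbundle `j : F ⟶ p^* E` there is exactly one `S`-morphism `g : T ⟶ G` such that
`g^* 𝒰` and `F` are the same subobject of `p^* E`. In other words, `G` represents the functor
sending `T` to the set of rank-`r` subbundles of the pullback of `E` to `T`. -/
structure IsGrassmannian {S G : Scheme.{u}} (r : ℕ) (E : S.Modules) (π : G ⟶ S) {𝒰 : G.Modules}
    (ι : 𝒰 ⟶ (Scheme.Modules.pullback π).obj E) : Prop where
  isSubbundle : IsSubbundle ι r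
  existsUnique : ∀ (T : Scheme.{u}) (p : T ⟶ S) (F : T.Modules)
    (j : F ⟶ (Scheme.Modules.pullback p).obj E), IsSubbundle j r →
      ∃! g : T ⟶ G, ∃ (h : g ≫ π = p) (e : (Scheme.Modules.pullback g).obj 𝒰 ≅ F),
        e.hom ≫ j = pullbackInclusion ι g p h

/-! ### Determinantal loci -/

/-- The ideal of `Γ(X, U)` generated by the `k × k` minors of `φ : E ⟶ H` on `U`, that is by the
determinants `det (θ a (φ (e b)))` for sections `e b` of `E` over `U` and `Γ(X, U)`-linear forms
`θ a` on `Γ(H, U)`. If `U` is affine and `E`, `H` are trivial on `U`, this is the ideal generated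
by the `k × k` minors of any matrix of `φ`. -/
def minorIdeal {X : Scheme.{u}} {E H : X.Modules} (φ : E ⟶ H) (k : ℕ) (U : X.Opens) :
    Ideal Γ(X, U) :=
  Ideal.span {c | ∃ (e : Fin k → Γ(E, U)) (θ : Fin k → (Γ(H, U) →ₗ[Γ(X, U)] Γ(X, U))),
    c = Matrix.det (Matrix.of fun a b : Fin k => θ a (φ.app U (e b)))}

/-- The ideal sheaf of the closed subscheme on which a morphism `φ : E ⟶ H` of vector bundles has
rank at most `k`; it is given on affine opens by the `(k + 1) × (k + 1)` minors of `φ`. For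
vector bundles these ideals are compatible with localization, so that `ofIdeals`
does not change them. -/
def rankLEIdeal {X : Scheme.{u}} {E H : X.Modules} (φ : E ⟶ H) (k : ℕ) : X.IdealSheafData :=
  Scheme.IdealSheafData.ofIdeals fun U => minorIdeal φ (k + 1) U.1

/-! ### Linked chains -/

/-- The data `(E_i, f_i, f^i)` of a chain `E_0 ⇄ E_1 ⇄ ⋯ ⇄ E_m` of modules on `X`
(so there are `n = m + 1` of them). -/
structure Chain (X : Scheme.{u}) (m : ℕ) where
  /-- the modules `E_i` -/
  obj : Fin (m + 1) → X.Modules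
  /-- the morphisms `f_i : E_i ⟶ E_{i+1}` -/
  up : ∀ i : Fin m, obj i.castSucc ⟶ obj i.succ
  /-- the morphisms `f^i : E_{i+1} ⟶ E_i` -/
  down : ∀ i : Fin m, obj i.succ ⟶ obj i.castSucc

namespace Chain

variable {X : Scheme.{u}} {m : ℕ}

/-- The pullback of a chain. -/
def pullback {Y : Scheme.{u}} (C : Chain X m) (p : Y ⟶ X) : Chain Y m where
  obj i := (Scheme.Modules.pullback p).obj (C.obj i)
  up i := (Scheme.Modules.pullback p).map (C.up i)
  down i := (Scheme.Modules.pullback p).map (C.down i)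

/-- The composition `E_i ⟶ E_{i-1} ⟶ ⋯ ⟶ E_0` of the morphisms `f^j`. -/
def toFirst (C : Chain X m) (i : Fin (m + 1)) : C.obj i ⟶ C.obj 0 :=
  Fin.induction (motive := fun i => C.obj i ⟶ C.obj 0) (𝟙 _) (fun j g => C.down j ≫ g) i

/-- The composition `E_i ⟶ E_{i+1} ⟶ ⋯ ⟶ E_m` of the morphisms `f_j`. -/
def toLast (C : Chain X m) (i : Fin (m + 1)) : C.obj i ⟶ C.obj (Fin.last m) :=
  Fin.reverseInduction (motive := fun i => C.obj i ⟶ C.obj (Fin.last m)) (𝟙 _)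
    (fun j g => C.up j ≫ g) i

end Chain

/-- The fiber `E(x)` of a module at a point: the global sections of its pullback to
`Spec κ(x)`. -/
abbrev fiber {X : Scheme.{u}} (E : X.Modules) (x : X) : Ab :=
  Γ((Scheme.Modules.pullback (X.fromSpecResidueField x)).obj E, ⊤)

/-- The map on fibers at a point induced by a morphism of modules. -/
def fiberMap {X : Scheme.{u}} {E H : X.Modules} (φ : E ⟶ H) (x : X) : fiber E x →+ fiber H x :=
  (((Scheme.Modules.pullback (X.fromSpecResidueField x)).map φ).app ⊤).hom

/-- The composition `φ ≫ ψ` is multiplication by the global function `s`. -/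
def CompEqSMul {X : Scheme.{u}} {E H : X.Modules} (φ : E ⟶ H) (ψ : H ⟶ E) (s : Γ(X, ⊤)) : Prop :=
  ∀ (U : X.Opens) (v : Γ(E, U)),
    (φ ≫ ψ).app U v = (X.presheaf.map (homOfLE (le_top : U ≤ ⊤)).op s) • v

/-- `C` is an `s`-linked chain of vector bundles of rank `d`. -/
structure IsLinkedChain {X : Scheme.{u}} {m : ℕ} (C : Chain X m) (d : ℕ) (s : Γ(X, ⊤)) :
    Prop where
  isVectorBundle : ∀ i, IsVectorBundle (C.obj i) d
  up_down : ∀ i, CompEqSMul (C.up i) (C.down i) s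
  down_up : ∀ i, CompEqSMul (C.down i) (C.up i) s
  /-- At points where `s` vanishes, `ker f^i = im f_i` on fibers. -/
  ker_down : ∀ x : X, X.Γevaluation x s = 0 → ∀ i,
    (fiberMap (C.down i) x).ker = (fiberMap (C.up i) x).range
  /-- At points where `s` vanishes, `ker f_i = im f^i` on fibers. -/
  ker_up : ∀ x : X, X.Γevaluation x s = 0 → ∀ i,
    (fiberMap (C.up i) x).ker = (fiberMap (C.down i) x).range
  /-- At points where `s` vanishes, `im f_i ∩ ker f_{i+1} = 0` on fibers. -/
  range_up_inf_ker_up : ∀ x : X, X.Γevaluation x s = 0 →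
    ∀ (i j : Fin m) (h : i.succ = j.castSucc),
      (fiberMap (C.up i ≫ eqToHom (congrArg C.obj h)) x).range ⊓ (fiberMap (C.up j) x).ker = ⊥
  /-- At points where `s` vanishes, `im f^{i+1} ∩ ker f^i = 0` on fibers. -/
  range_down_inf_ker_down : ∀ x : X, X.Γevaluation x s = 0 →
    ∀ (i j : Fin m) (h : i.succ = j.castSucc),
      (fiberMap (C.down j ≫ eqToHom (congrArg C.obj h.symm)) x).range ⊓
        (fiberMap (C.down i) x).ker = ⊥

/-! ### Linked determinantal loci and linked Grassmannians -/

/-- The morphism `E_i ⟶ (E_0 / F) ⊕ (E_m / F')`. -/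
def toQuotients {X : Scheme.{u}} {m : ℕ} (C : Chain X m) {F F' : X.Modules} (ι : F ⟶ C.obj 0)
    (ι' : F' ⟶ C.obj (Fin.last m)) (i : Fin (m + 1)) :
    C.obj i ⟶ cokernel ι ⊞ cokernel ι' :=
  biprod.lift (C.toFirst i ≫ cokernel.π ι) (C.toLast i ≫ cokernel.π ι')

/-- The ideal sheaf of the linked determinantal locus of a chain of bundles of rank `d` and of
rank-`r` subbundles of its first and last members: the closed subscheme on which all the morphisms
`E_i ⟶ (E_0 / F) ⊕ (E_m / F')` have rank at most `d - r`. -/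
def linkedDetIdeal {X : Scheme.{u}} {m : ℕ} (C : Chain X m) (d r : ℕ) {F F' : X.Modules}
    (ι : F ⟶ C.obj 0) (ι' : F' ⟶ C.obj (Fin.last m)) : X.IdealSheafData :=
  ⨆ i, rankLEIdeal (toQuotients C ι ι' i) (d - r)

/-- The ideal sheaf of the closed subscheme on which the subbundles `F_i` of `E_i` are linked,
that is `f_i (F_i) ⊆ F_{i+1}` and `f^i (F_{i+1}) ⊆ F_i`: the morphisms `F_i ⟶ E_{i+1} / F_{i+1}`
and `F_{i+1} ⟶ E_i / F_i` have rank at most `0`. -/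
def linkedIdeal {X : Scheme.{u}} {m : ℕ} (C : Chain X m) {F : Fin (m + 1) → X.Modules}
    (ι : ∀ i, F i ⟶ C.obj i) : X.IdealSheafData :=
  (⨆ i : Fin m, rankLEIdeal (ι i.castSucc ≫ C.up i ≫ cokernel.π (ι i.succ)) 0) ⊔
    ⨆ i : Fin m, rankLEIdeal (ι i.succ ≫ C.down i ≫ cokernel.π (ι i.castSucc)) 0

section Universal

variable {S₀ : Scheme.{u}} {m : ℕ} (C : Chain S₀ m) (d : ℕ) (r : ℕ)
  {G : Fin (m + 1) → Scheme.{u}} (π : ∀ i, G i ⟶ S₀) {𝒰 : ∀ i, (G i).Modules}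
  (ι : ∀ i, 𝒰 i ⟶ (Scheme.Modules.pullback (π i)).obj (C.obj i))

/-- The fiber product `G_0 ×_{S₀} ⋯ ×_{S₀} G_m`. -/
abbrev totalProduct : Scheme.{u} := widePullback S₀ G π

/-- The fiber product `G_0 ×_{S₀} G_m` of the first and last factors. -/
abbrev endsProduct : Scheme.{u} := Limits.pullback (π 0) (π (Fin.last m))

/-- The projection to the first and last factors. -/
def projection : totalProduct π ⟶ endsProduct π :=
  pullback.lift (WidePullback.π π 0) (WidePullback.π π (Fin.last m)) (by simp)

/-- The structure morphism of `G_0 ×_{S₀} G_m`. -/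
def endsBase : endsProduct π ⟶ S₀ := pullback.fst (π 0) (π (Fin.last m)) ≫ π 0

/-- The linked Grassmannian: the closed subscheme of linked tuples of subbundles in
`G_0 ×_{S₀} ⋯ ×_{S₀} G_m`, where `G_i` is the Grassmannian of `E_i` with
universal subbundle `𝒰_i`. -/
def linkedGrassmannianIdeal : (totalProduct π).IdealSheafData :=
  linkedIdeal (C.pullback (WidePullback.base π))
    fun i => pullbackInclusion (ι i) (WidePullback.π π i) (WidePullback.base π) (by simp)

/-- The linked determinantal locus on `G_0 ×_{S₀} G_m` of the pullback of the chain and of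
the pullbacks of the universal subbundles on the two factors. -/
def universalLinkedDetIdeal : (endsProduct π).IdealSheafData :=
  linkedDetIdeal (C.pullback (endsBase π)) d r
    (pullbackInclusion (ι 0) (pullback.fst (π 0) (π (Fin.last m))) (endsBase π) rfl)
    (pullbackInclusion (ι (Fin.last m)) (pullback.snd (π 0) (π (Fin.last m))) (endsBase π)
      pullback.condition.symm)

end Universal

end

end LinkedDet

/-! Over a field `K`, a point of the product of the two end Grassmannians is a point `q` of `S₀`
together with `r`-dimensional subspaces `W₀` and `W₁` of the fibers of `E_0` and `E_m`. Let `K_i` be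
the kernel of `E_i → E_0 / W₀ ⊕ E_m / W₁` on fibers, that is, the vectors whose images at both ends
lie in `W₀` and `W₁`. By rank-nullity the determinantal conditions say that every `K_i` has
dimension at least `r`. Members of a linked family with ends `W₀`, `W₁` lie in the `K_i`, so the
linked Grassmannian maps into the locus.

For the converse, the `K_i` themselves form a linked family, because the composites of `f_i` and
`f^i` are scalars. If `s ≠ 0` at `q`, the map from `E_i` to `E_0` is injective, so each `K_i` has
dimension exactly `r`. If `s = 0`, the family is shrunk (`IsLinkedFamily.exists_finrank_eq`). Where
the dimension first jumps, from `r` at `a` to more than `r` at `a + 1`, the vanishing of `im f^{a+1}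
∩ ker f^a` implies that the images of the two neighbours do not fill `K_{a+1}`
(`IsLinkedFamily.map_sup_map_lt`). A hyperplane section containing these images can replace
`K_{a+1}`, and the total dimension drops.

Passing between schemes and vector spaces rests on two facts. Membership in a rank locus is detected
by the rank on the fiber at any field-valued point (`mem_support_rankLEIdeal_iff`), and field-valued
points of a Grassmannian are the `r`-dimensional subspaces of the fiber
(`IsGrassmannian.eq_of_fiberSubspace_eq`, `IsGrassmannian.exists_fiberSubspace_eq`). Working over
the residue field of the given point, the subspaces found above define a point of the full product
over it. -/

namespace LinkedDet

/-! ### Linear algebra: ranks and minors. -/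

section LinearAlgebra

open Module

/-- A family of linear forms separating the points of a finite-dimensional space contains `n` forms
whose pairing matrix with `n` given linearly independent vectors is invertible. -/
lemma exists_det_ne_zero_of_linearIndependent {k V : Type*} [Field k] [AddCommGroup V] [Module k V]
    {n : ℕ} {v : Fin n → V} (hv : LinearIndependent k v) (S : Set (V →ₗ[k] k))
    (hS : ∀ x : V, (∀ θ ∈ S, θ x = 0) → x = 0) :
    ∃ θ : Fin n → V →ₗ[k] k, (∀ a, θ a ∈ S) ∧
      (Matrix.of fun a b => θ a (v b)).det ≠ 0 := by
  classical
  let ρ : (V →ₗ[k] k) → (Fin n → k) := fun θ b => θ (v b)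
  -- Otherwise a nonzero functional `f` on `k ^ n` kills `ρ '' S`. Then the combination of the `v b`
  -- with coefficients `f (Pi.single b 1)` is killed by `S`, hence zero, against the independence of
  -- `v`. A basis of `k ^ n` drawn from `ρ '' S` then supplies the rows of the matrix.
  have hspan : Submodule.span k (ρ '' S) = ⊤ := by
    by_contra hne
    obtain ⟨f, hf0, hf⟩ := Submodule.exists_le_ker_of_lt_top _ (lt_top_iff_ne_top.2 hne)
    refine hf0 ?_
    have hzero : ∑ b, f (Pi.single b 1) • v b = 0 := by
      refine hS _ fun θ hθ => ?_
      have h1 : f (ρ θ) = 0 := hf (Submodule.subset_span ⟨θ, hθ, rfl⟩)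
      have h2 : ρ θ = ∑ b, (θ (v b)) • (Pi.single b 1 : Fin n → k) := by
        ext b; simp [ρ, Finset.sum_apply, Pi.single_apply]
      rw [h2, map_sum] at h1
      rw [map_sum, ← h1]
      exact Finset.sum_congr rfl fun b _ => by simp [mul_comm]
    have := Fintype.linearIndependent_iff.1 hv _ hzero
    refine LinearMap.pi_ext' fun b => LinearMap.ext_ring ?_
    simpa using this b
  obtain ⟨B, hBS, hBspan, hBli⟩ := exists_linearIndependent k (ρ '' S)
  have hBtop : Submodule.span k B = ⊤ := hBspan.trans hspan
  let b : Basis B k (Fin n → k) := Basis.mk hBli (by simp [hBtop])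
  let e : Fin n ≃ B := (Pi.basisFun k (Fin n)).indexEquiv b
  have hmem : ∀ a : Fin n, ∃ θ ∈ S, ρ θ = (e a : Fin n → k) := fun a => hBS (e a).2
  choose θ hθS hθ using hmem
  refine ⟨θ, hθS, ?_⟩
  have hli : LinearIndependent k (fun a => ((e a : B) : Fin n → k)) :=
    hBli.comp e e.injective
  have : (Matrix.of fun a b => θ a (v b)) = Matrix.of fun a => ((e a : B) : Fin n → k) := by
    ext a b; exact congrFun (hθ a) b
  rw [this]
  exact (Matrix.linearIndependent_rows_iff_isUnit.1 hli |> (Matrix.isUnit_iff_isUnit_det _).1).ne_zero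

/-- If the determinant were nonzero, the columns, which are the images of the `f (e b)` under the
map with components `θ`, would be independent. The range of `f` would then contain `n` independent
vectors. -/
lemma det_eq_zero_of_finrank_range_lt {k V W : Type*} [Field k] [AddCommGroup V] [Module k V]
    [AddCommGroup W] [Module k W] [FiniteDimensional k V] {n : ℕ} (f : V →ₗ[k] W)
    (hf : finrank k (LinearMap.range f) < n) (e : Fin n → V) (θ : Fin n → W →ₗ[k] k) :
    (Matrix.of fun a b => θ a (f (e b))).det = 0 := by
  by_contra hne
  have hcol := Matrix.linearIndependent_cols_iff_isUnit.2
    ((Matrix.isUnit_iff_isUnit_det _).2 (isUnit_iff_ne_zero.2 hne))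
  let L : W →ₗ[k] (Fin n → k) := LinearMap.pi θ
  have hli : LinearIndependent k fun b => L (f (e b)) := hcol
  have hli2 : LinearIndependent k fun b => (⟨f (e b), e b, rfl⟩ : LinearMap.range f) := by
    refine LinearIndependent.of_comp (L ∘ₗ (LinearMap.range f).subtype) ?_
    exact hli
  have := hli2.fintype_card_le_finrank
  simp at this
  omega

open TensorProduct in
/-- The rank of a linear map after base change to a field is bounded by `n` if and only if its
`(n + 1) × (n + 1)` minors vanish in the field. -/
lemma finrank_range_baseChange_le_iff {A k M N : Type*} [CommRing A] [Field k] [Algebra A k]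
    [AddCommGroup M] [Module A M] [Module.Finite A M] [AddCommGroup N] [Module A N]
    [Module.Free A N] [Module.Finite A N] (f : M →ₗ[A] N) (n : ℕ) :
    finrank k (LinearMap.range (f.baseChange k)) ≤ n ↔
      ∀ (e : Fin (n + 1) → M) (θ : Fin (n + 1) → N →ₗ[A] A),
        algebraMap A k (Matrix.of fun a b => θ a (f (e b))).det = 0 := by
  have key : ∀ (e : Fin (n + 1) → M) (θ : Fin (n + 1) → N →ₗ[A] A),
      algebraMap A k (Matrix.of fun a b => θ a (f (e b))).det =
      (Matrix.of fun a b => ((AlgebraTensorModule.rid A k k).toLinearMap ∘ₗ (θ a).baseChange k)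
        (f.baseChange k (1 ⊗ₜ e b))).det := by
    intro e θ
    rw [RingHom.map_det]
    congr 1
    ext a b
    simp [Algebra.smul_def]
  constructor
  · intro h e θ
    rw [key]
    exact det_eq_zero_of_finrank_range_lt _ (Nat.lt_succ_of_le h) (fun b => 1 ⊗ₜ e b)
      (fun a => (AlgebraTensorModule.rid A k k).toLinearMap ∘ₗ (θ a).baseChange k)
  · intro h
    by_contra! hlt
    -- The range is spanned over `k` by images of pure tensors `1 ⊗ₜ m`, so a rank above `n` yields
    -- `n + 1` independent vectors that come from `M` itself.
    let T : Set (k ⊗[A] N) := Set.range fun m : M => f.baseChange k (1 ⊗ₜ m)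
    have hT : Submodule.span k T = LinearMap.range (f.baseChange k) := by
      have : T = (f.baseChange k) '' (Set.range fun m : M => (1 : k) ⊗ₜ[A] m) := by
        rw [← Set.range_comp]; rfl
      rw [this, Submodule.span_image, LinearMap.range_eq_map]
      congr 1
      have h1 := Submodule.baseChange_span (R := A) (M := M) (A := k) (Set.univ : Set M)
      rw [Submodule.span_univ, Submodule.baseChange_top, Set.image_univ] at h1
      exact h1.symm
    obtain ⟨B, hBT, hBspan, hBli⟩ := exists_linearIndependent k T
    have hfin : Module.Finite k (Submodule.span k B) := inferInstance
    have hBfin : Finite B := (hBli.finite)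
    have := Fintype.ofFinite B
    have hcard : Fintype.card B = finrank k (LinearMap.range (f.baseChange k)) := by
      rw [← hT, ← hBspan, finrank_span_set_eq_card hBli, Set.toFinset_card]
    obtain ⟨emb⟩ : Nonempty (Fin (n + 1) ↪ B) := by
      rw [Function.Embedding.nonempty_iff_card_le]
      simp only [Fintype.card_fin]; omega
    have hmem : ∀ b : Fin (n + 1), ∃ m : M, f.baseChange k (1 ⊗ₜ m) = (emb b : k ⊗[A] N) :=
      fun b => hBT (emb b).2
    choose e he using hmem
    have hli : LinearIndependent k fun b => f.baseChange k (1 ⊗ₜ e b) := by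
      simp_rw [he]; exact hBli.comp emb emb.injective
    -- The forms on `k ⊗ N` that come from `A`-linear forms on `N` separate points, since they
    -- include the coordinates of a basis of `N`. The nonzero minor is therefore the image of a
    -- minor over `A`.
    obtain ⟨θ, hθ, hdet⟩ := exists_det_ne_zero_of_linearIndependent hli
      (Set.range fun θ : N →ₗ[A] A =>
        (AlgebraTensorModule.rid A k k).toLinearMap ∘ₗ θ.baseChange k) (by
        intro x hx
        let b := (Module.Free.chooseBasis A N)
        refine (b.baseChange k).ext_elem fun i => ?_
        have := hx _ ⟨b.coord i, rfl⟩
        rw [map_zero, Finsupp.zero_apply, ← this]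
        clear this hx
        induction x with
        | zero => simp
        | add x y hx hy => simp only [map_add, Finsupp.add_apply, hx, hy]
        | tmul c y => simp [Algebra.smul_def, mul_comm])
    choose θ' hθ' using hθ
    refine hdet ?_
    rw [← h e θ', key]
    congr 1
    ext a b
    simp only [Matrix.of_apply, ← hθ']

/-- In a finite-dimensional space, a subspace `W` of dimension greater than `r` that is strictly
larger than `S` contains a strictly smaller subspace of dimension at least `r` containing `S`. -/
lemma exists_submodule_between {k V : Type*} [Field k] [AddCommGroup V] [Module k V]
    [FiniteDimensional k V] {S W : Submodule k V} (h : S < W) {r : ℕ} (hr : r < finrank k W) :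
    ∃ H : Submodule k V, S ≤ H ∧ H < W ∧ r ≤ finrank k H := by
  obtain ⟨v, hvW, hvS⟩ := SetLike.exists_of_lt h
  obtain ⟨f, hfv, hf⟩ := Submodule.exists_le_ker_of_notMem hvS
  -- The hyperplane `ker f` contains `S` but not `v`; intersecting with it lowers the dimension of
  -- `W` by at most one.
  refine ⟨W ⊓ LinearMap.ker f, le_inf h.le hf, lt_of_le_of_ne inf_le_left ?_, ?_⟩
  · intro heq
    have : v ∈ W ⊓ LinearMap.ker f := by rw [heq]; exact hvW
    exact hfv this.2
  · have h1 := Submodule.finrank_sup_add_finrank_inf_eq W (LinearMap.ker f)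
    have h2 := Submodule.finrank_le (W ⊔ LinearMap.ker f)
    have h3 := LinearMap.finrank_range_add_finrank_ker f
    have h4 := Submodule.finrank_le (LinearMap.range f)
    rw [finrank_self] at h4
    omega

/-! ### Linked families of subspaces and how to shrink them. -/

section Chain

variable {k : Type*} [Field k] {m : ℕ} {V : Fin (m + 1) → Type*} [∀ i, AddCommGroup (V i)]
  [∀ i, Module k (V i)] (up : ∀ i : Fin m, V i.castSucc →ₗ[k] V i.succ)
  (down : ∀ i : Fin m, V i.succ →ₗ[k] V i.castSucc)

/-- A family of subspaces of the members of a chain that is preserved by the maps of the chain. -/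
def IsLinkedFamily (K : ∀ i, Submodule k (V i)) : Prop :=
  (∀ i : Fin m, (K i.castSucc).map (up i) ≤ K i.succ) ∧
    ∀ i : Fin m, (K i.succ).map (down i) ≤ K i.castSucc

variable [∀ i, FiniteDimensional k (V i)] {up down}

/-- Where the dimension of a linked family first exceeds that of its predecessor, the member is
not spanned by the images of its two neighbours. -/
lemma IsLinkedFamily.map_sup_map_lt {K : ∀ i, Submodule k (V i)} (hK : IsLinkedFamily up down K)
    (hud : ∀ i, up i ∘ₗ down i = 0) (hdu : ∀ i, down i ∘ₗ up i = 0) (a : Fin m) (ha : a.1 + 1 < m)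
    (hdd : ∀ x : V (Fin.succ ⟨a.1 + 1, ha⟩), down a (down ⟨a.1 + 1, ha⟩ x) = 0 →
      down ⟨a.1 + 1, ha⟩ x = 0)
    (hlt : finrank k (K a.castSucc) < finrank k (K a.succ)) :
    (K a.castSucc).map (up a) ⊔ (K (Fin.succ ⟨a.1 + 1, ha⟩)).map (down ⟨a.1 + 1, ha⟩) <
      K a.succ := by
  refine lt_of_le_of_ne (sup_le (hK.1 a) (hK.2 ⟨a.1 + 1, ha⟩)) fun heq => ?_
  -- Compare `down a` on `K_{a+1}` with `up a` on `K_a`. If the neighbours filled `K_{a+1}`, then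
  -- `ker D ⊆ range U`, while `range D ⊆ ker U` always holds. Rank-nullity for both maps would give
  -- `dim K_{a+1} ≤ dim K_a`.
  let D : K a.succ →ₗ[k] V a.castSucc := down a ∘ₗ (K a.succ).subtype
  let U : K a.castSucc →ₗ[k] V a.succ := up a ∘ₗ (K a.castSucc).subtype
  have hD := LinearMap.finrank_range_add_finrank_ker D
  have hU := LinearMap.finrank_range_add_finrank_ker U
  have h1 : finrank k (LinearMap.ker D) ≤ finrank k (LinearMap.range U) := by
    rw [← LinearMap.finrank_range_of_inj (f := (K a.succ).subtype ∘ₗ (LinearMap.ker D).subtype)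
      (Subtype.val_injective.comp Subtype.val_injective)]
    refine Submodule.finrank_mono ?_
    rintro _ ⟨⟨⟨x, hx⟩, hxD⟩, rfl⟩
    rw [← heq] at hx
    obtain ⟨_, ⟨y, hy, rfl⟩, _, ⟨z, hz, rfl⟩, rfl⟩ := Submodule.mem_sup.1 hx
    have hxD' : down a (@HAdd.hAdd (V a.succ) (V a.succ) (V a.succ) _ (up a y)
      (down ⟨a.1 + 1, ha⟩ z)) = 0 := hxD
    -- The part of `x` coming from `K_a` is killed by `down a`, so the part coming from `K_{a+2}` is
    -- killed too. By `hdd` the latter vanishes, leaving `x` in the image of `K_a`.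
    have hdz : down a (down ⟨a.1 + 1, ha⟩ z) = 0 := by
      rwa [map_add, show down a (up a y) = 0 from LinearMap.congr_fun (hdu a) y,
        zero_add] at hxD'
    refine ⟨⟨y, hy⟩, ?_⟩
    have hz0 : @HAdd.hAdd (V a.succ) (V a.succ) (V a.succ) _ (up a y)
        (down ⟨a.1 + 1, ha⟩ z) = up a y := by
      rw [hdd z hdz]; exact add_zero _
    exact hz0.symm
  have h2 : finrank k (LinearMap.range D) ≤ finrank k (LinearMap.ker U) := by
    rw [← LinearMap.finrank_range_of_inj (f := (K a.castSucc).subtype ∘ₗ (LinearMap.ker U).subtype)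
      (Subtype.val_injective.comp Subtype.val_injective)]
    refine Submodule.finrank_mono ?_
    rintro _ ⟨⟨x, hx⟩, rfl⟩
    exact ⟨⟨⟨down a x, hK.2 a ⟨x, hx, rfl⟩⟩, LinearMap.congr_fun (hud a) x⟩, rfl⟩
  omega

/-- A linked family of subspaces of dimension at least `r`, with equality at both ends, contains a
linked family of subspaces of dimension `r`. -/
theorem IsLinkedFamily.exists_finrank_eq (hud : ∀ i, up i ∘ₗ down i = 0)
    (hdu : ∀ i, down i ∘ₗ up i = 0)
    (hdd : ∀ (a : Fin m) (ha : a.1 + 1 < m) (x : V (Fin.succ ⟨a.1 + 1, ha⟩)),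
      down a (down ⟨a.1 + 1, ha⟩ x) = 0 → down ⟨a.1 + 1, ha⟩ x = 0)
    {r : ℕ} {K : ∀ i, Submodule k (V i)} (hK : IsLinkedFamily up down K)
    (hr : ∀ i, r ≤ finrank k (K i)) (h0 : finrank k (K 0) = r)
    (hl : finrank k (K (Fin.last m)) = r) :
    ∃ W : ∀ i, Submodule k (V i), IsLinkedFamily up down W ∧ (∀ i, W i ≤ K i) ∧
      ∀ i, finrank k (W i) = r := by
  induction hN : ∑ i, finrank k (K i) using Nat.strong_induction_on generalizing K with
  | _ N ih =>
  by_cases hall : ∀ i, finrank k (K i) = r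
  · exact ⟨K, hK, fun _ => le_rfl, hall⟩
  -- Dimension `r` at the start and no jump from `r` to a larger value would give dimension `r`
  -- everywhere.
  have hex : ∃ a : Fin m, finrank k (K a.castSucc) = r ∧ r < finrank k (K a.succ) := by
    by_contra! hcon
    refine hall fun i => ?_
    induction i using Fin.induction with
    | zero => exact h0
    | succ i hi => exact le_antisymm (hcon i hi) (hr _)
  obtain ⟨a, ha0, ha1⟩ := hex
  -- The jump cannot land on the last member, whose dimension is `r`; so `K_{a+1}` has neighbours on
  -- both sides.
  have ha : a.1 + 1 < m := by
    by_contra hcon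
    have : a.succ = Fin.last m := by ext; simp; omega
    rw [this] at ha1
    omega
  -- Since `H` contains the images of both neighbours, replacing `K_{a+1}` by it preserves linkage.
  -- The maps leaving position `a + 1` cause no trouble, because their source only shrinks.
  obtain ⟨H, hSH, hHK, hrH⟩ := exists_submodule_between
    (hK.map_sup_map_lt hud hdu a ha (hdd a ha) (by omega)) ha1
  let K' := Function.update K a.succ H
  have hK'self : K' a.succ = H := Function.update_self ..
  have hK'ne : ∀ {i}, i ≠ a.succ → K' i = K i := fun h => Function.update_of_ne h ..
  have hK'K : ∀ i, K' i ≤ K i := by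
    intro i
    by_cases h : i = a.succ
    · subst h; rw [hK'self]; exact hHK.le
    · rw [hK'ne h]
  have hlink : IsLinkedFamily up down K' := by
    refine ⟨fun i => ?_, fun i => ?_⟩
    · by_cases h : i.succ = a.succ
      · obtain rfl := Fin.succ_injective _ h
        rw [hK'self, hK'ne (Fin.castSucc_lt_succ).ne]
        exact le_sup_left.trans hSH
      · rw [hK'ne h]
        exact (Submodule.map_mono (hK'K _)).trans (hK.1 i)
    · by_cases h : i.castSucc = a.succ
      · obtain rfl : i = ⟨a.1 + 1, ha⟩ := by
          ext; simpa using congrArg Fin.val h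
        refine le_trans ?_ (hSH.trans hK'self.ge)
        rw [hK'ne (by intro h; have := congrArg Fin.val h; simp at this)]
        exact le_sup_right
      · rw [hK'ne h]
        exact (Submodule.map_mono (hK'K _)).trans (hK.2 i)
  have hrK' : ∀ i, r ≤ finrank k (K' i) := by
    intro i
    by_cases h : i = a.succ
    · subst h; rw [hK'self]; exact hrH
    · rw [hK'ne h]; exact hr i
  have hsum : ∑ i, finrank k (K' i) < N := by
    rw [← hN]
    refine Finset.sum_lt_sum (fun i _ => Submodule.finrank_mono (hK'K i))
      ⟨a.succ, Finset.mem_univ _, ?_⟩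
    rw [hK'self]
    exact Submodule.finrank_lt_finrank_of_lt hHK
  obtain ⟨W, hW, hWK, hWr⟩ := ih _ hsum hlink hrK'
    (le_antisymm ((Submodule.finrank_mono (hK'K _)).trans h0.le) (hrK' _))
    (le_antisymm ((Submodule.finrank_mono (hK'K _)).trans hl.le) (hrK' _)) rfl
  exact ⟨W, hW, fun i => (hWK i).trans (hK'K i), hWr⟩

end Chain

end LinearAlgebra

end LinkedDet

namespace LinkedDet

/-! ### Finite presentation and ideals of minors under localization. -/

section Localization

/-- Finite presentation of a module can be checked after localization at elements generating the
unit ideal. -/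
theorem finitePresentation_of_localizationSpan {R M : Type*} [CommRing R] [AddCommGroup M]
    [Module R M] (t : Set R) (ht : Ideal.span t = ⊤)
    {Mₚ : ∀ _ : t, Type*} [∀ g : t, AddCommGroup (Mₚ g)] [∀ g : t, Module R (Mₚ g)]
    {Rₚ : ∀ _ : t, Type*} [∀ g : t, CommRing (Rₚ g)] [∀ g : t, Algebra R (Rₚ g)]
    [∀ g : t, IsLocalization.Away g.val (Rₚ g)]
    [∀ g : t, Module (Rₚ g) (Mₚ g)] [∀ g : t, IsScalarTower R (Rₚ g) (Mₚ g)]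
    (f : ∀ g : t, M →ₗ[R] Mₚ g) [∀ g : t, IsLocalizedModule (Submonoid.powers g.val) (f g)]
    (H : ∀ g : t, Module.FinitePresentation (Rₚ g) (Mₚ g)) :
    Module.FinitePresentation R M := by
  have : Module.Finite R M :=
    Module.Finite.of_localizationSpan' t ht f fun g => (inferInstance : Module.Finite (Rₚ g) (Mₚ g))
  obtain ⟨n, l, hl⟩ := Module.Finite.exists_fin' R M
  -- What remains is finite generation of the kernel, which is local; localization turns this kernel
  -- into the kernel of the localized surjection.
  rw [← Module.FinitePresentation.fg_ker_iff l hl]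
  let ϕ : ∀ g : t, (Fin n → R) →ₗ[R] (Fin n → Rₚ g) := fun g =>
    LinearMap.pi fun i => Algebra.linearMap R (Rₚ g) ∘ₗ LinearMap.proj i
  have : ∀ g : t, IsLocalizedModule (Submonoid.powers g.val) (ϕ g) := fun g =>
    inferInstance
  refine Submodule.of_localizationSpan' t ht (Rₚ := Rₚ) ϕ fun g => ?_
  rw [LinearMap.localized'_ker_eq_ker_localizedMap (Rₚ g) (Submonoid.powers g.1) (ϕ g) (f g) l]
  refine Module.FinitePresentation.fg_ker _ ?_
  exact IsLocalizedModule.map_surjective (Submonoid.powers g.1) (ϕ g) (f g) l hl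

/-- The ideal generated by the `k × k` minors of a linear map. -/
def linearMinorIdeal {A M N : Type*} [CommRing A] [AddCommGroup M] [Module A M]
    [AddCommGroup N] [Module A N] (φ : M →ₗ[A] N) (k : ℕ) : Ideal A :=
  Ideal.span {c | ∃ (e : Fin k → M) (θ : Fin k → N →ₗ[A] A),
    c = (Matrix.of fun a b => θ a (φ (e b))).det}

/-- The ideals of minors are compatible with localization. -/
theorem map_linearMinorIdeal {A B M N M' N' : Type*} [CommRing A] [CommRing B] [Algebra A B]
    (S : Submonoid A) [IsLocalization S B]
    [AddCommGroup M] [Module A M] [AddCommGroup N] [Module A N] [Module.FinitePresentation A N]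
    [AddCommGroup M'] [Module A M'] [Module B M'] [IsScalarTower A B M']
    [AddCommGroup N'] [Module A N'] [Module B N'] [IsScalarTower A B N']
    (p : M →ₗ[A] M') [IsLocalizedModule S p] (q : N →ₗ[A] N') [IsLocalizedModule S q]
    (φ : M →ₗ[A] N) (φ' : M' →ₗ[B] N') (h : ∀ x, φ' (p x) = q (φ x)) (k : ℕ) :
    (linearMinorIdeal φ k).map (algebraMap A B) = linearMinorIdeal φ' k := by
  refine le_antisymm ?_ ?_
  · rw [linearMinorIdeal, Ideal.map_span, Ideal.span_le]
    rintro _ ⟨_, ⟨e, θ, rfl⟩, rfl⟩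
    refine Ideal.subset_span ⟨fun b => p (e b), fun a =>
      IsLocalizedModule.mapExtendScalars S q (Algebra.linearMap A B) B (θ a), ?_⟩
    rw [RingHom.map_det]
    congr 1
    ext a b
    simp [h, IsLocalizedModule.mapExtendScalars_apply_apply, IsLocalizedModule.map_apply]
  · rw [linearMinorIdeal, Ideal.span_le]
    rintro _ ⟨e', θ', rfl⟩
    -- Denominators are cleared in the vectors and, using finite presentation of `N`, in the linear
    -- forms. This rescales rows and columns by elements of `S`, so the minor changes by a unit of
    -- `B`.
    have he : ∀ b, ∃ (e : M) (s : S), s • e' b = p e := fun b => by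
      obtain ⟨⟨e, s⟩, hs⟩ := IsLocalizedModule.surj S p (e' b)
      exact ⟨e, s, hs⟩
    choose e s hs using he
    have hθ : ∀ a, ∃ (θ : N →ₗ[A] A) (t : S), Algebra.linearMap A B ∘ₗ θ =
        t • ((θ' a).restrictScalars A ∘ₗ q) := fun a =>
      Module.FinitePresentation.exists_lift_of_isLocalizedModule S (Algebra.linearMap A B) _
    choose θ t ht using hθ
    have hmem : algebraMap A B (Matrix.of fun a b => θ a (φ (e b))).det ∈
        (linearMinorIdeal φ k).map (algebraMap A B) :=
      Ideal.mem_map_of_mem _ (Ideal.subset_span ⟨e, θ, rfl⟩)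
    have hdet : algebraMap A B (Matrix.of fun a b => θ a (φ (e b))).det =
        (∏ a, algebraMap A B (t a)) * ((∏ b, algebraMap A B (s b)) *
          (Matrix.of fun a b => θ' a (φ' (e' b))).det) := by
      rw [← Matrix.det_mul_row, ← Matrix.det_mul_column, RingHom.map_det]
      congr 1
      ext a b
      have h1 := LinearMap.congr_fun (ht a) (φ (e b))
      simp only [LinearMap.comp_apply, Algebra.linearMap_apply, LinearMap.smul_apply,
        LinearMap.restrictScalars_apply, ← h, ← hs, Submonoid.smul_def] at h1
      simp only [RingHom.mapMatrix_apply, Matrix.map_apply, Matrix.of_apply, h1]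
      rw [← algebraMap_smul B (s b : A) (e' b), map_smul, map_smul, Algebra.smul_def, smul_eq_mul]
    rw [hdet, Ideal.unit_mul_mem_iff_mem, Ideal.unit_mul_mem_iff_mem] at hmem
    · exact hmem
    · exact IsUnit.prod_univ_iff.2 fun b => IsLocalization.map_units B (s b)
    · exact IsUnit.prod_univ_iff.2 fun a => IsLocalization.map_units B (t a)

end Localization

end LinkedDet

namespace LinkedDet

/-! ### Quasi-coherence of locally free modules. -/

noncomputable section

/-- The presentation of a free module without relations. -/
def freePresentation (X : Scheme.{u}) (I : Type u) :
    SheafOfModules.Presentation (R := X.ringCatSheaf) (SheafOfModules.free I) where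
  generators := SheafOfModules.free.generatingSections I
  relations :=
    { I := ULift Empty
      s := fun j => Empty.rec _ j.down
      epi := IsZero.epi (IsZero.of_iso (isZero_zero _) (Limits.kernel.ofMono _)) _ }

/-- A module over a scheme with a presentation on each member of an open cover is
quasi-coherent. -/
theorem isQuasicoherent_of_presentation {X : Scheme.{u}} (E : X.Modules)
    (h : ∀ x : X, ∃ U : X.Opens, x ∈ U ∧ Nonempty (E.restrict U.ι).Presentation) :
    E.IsQuasicoherent := by
  choose U hxU hU using h
  refine SheafOfModules.QuasicoherentData.isQuasicoherent (C := X.Opens) (R := X.ringCatSheaf)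
    { I := X
      X := U
      coversTop := ?_
      presentation := fun x => ?_ }
  · exact (_root_.Opens.coversTop_iff _ U).2
      (eq_top_iff.2 fun x _ => TopologicalSpace.Opens.mem_iSup.2 ⟨x, hxU x⟩)
  -- Quasi-coherence asks for presentations over the slice site of `U x`. The presentation on the
  -- open subscheme is carried there by the inverse equivalence, which preserves colimits and,
  -- through `η`, the structure sheaf.
  · let e := Scheme.Modules.overEquiv (U x)
    let i := Scheme.Modules.overFunctorEquiv (U x)
    let P := (hU x).some
    let F := e.inverse
    let η : SheafOfModules.unit (X.ringCatSheaf.over (U x)) ≅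
        e.inverse.obj (SheafOfModules.unit (U x : Scheme.{u}).ringCatSheaf) :=
      e.unitIso.app _ ≪≫ e.inverse.mapIso (i.app (SheafOfModules.unit X.ringCatSheaf) ≪≫
        Scheme.Modules.restrictUnitIso _)
    let j : e.inverse.obj (E.restrict (U x).ι) ≅ SheafOfModules.over E (U x) :=
      e.inverse.mapIso (i.app E).symm ≪≫ (e.unitIso.app _).symm
    have hF : PreservesColimits e.inverse := e.symm.toAdjunction.leftAdjoint_preservesColimits
    let Q := @SheafOfModules.Presentation.map _ _ _ _ _ _ _ _ _ _ _ _ _ P e.inverse hF η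
    exact @SheafOfModules.Presentation.ofIsIso.{u, u, u} _ _ _ _ _ _ _ _ j.hom
      (Iso.isIso_hom j) Q

theorem IsFiniteLocallyFree.isQuasicoherent {X : Scheme.{u}} {E : X.Modules}
    (hE : IsFiniteLocallyFree E) : E.IsQuasicoherent := by
  refine isQuasicoherent_of_presentation E fun x => ?_
  obtain ⟨U, d, hxU, ⟨e⟩⟩ := hE x
  exact ⟨U, hxU, ⟨@SheafOfModules.Presentation.ofIsIso.{u, u, u} _ _ _ _ _ _ _ _ e.inv
    (Iso.isIso_inv e) (freePresentation _ _)⟩⟩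

end

noncomputable section

/-! ### Fibers as base changes of modules of sections. -/

section PullbackTilde

variable {A K : CommRingCat.{u}} (ψ : A ⟶ K)

/-- Global sections of the pushforward along `Spec.map ψ` are the restriction of scalars of the
global sections. -/
def pushforwardCompΓIso :
    Scheme.Modules.pushforward (Spec.map ψ) ⋙ moduleSpecΓFunctor (R := A) ≅
      moduleSpecΓFunctor (R := K) ⋙ ModuleCat.restrictScalars ψ.hom :=
  Functor.isoWhiskerRight (pushforwardCompModulesSpecToSheafIso ψ)
    (TopCat.Sheaf.forget _ _ ⋙ (evaluation _ _).obj (.op ⊤))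

/-- The pullback of `M^~` along `Spec.map ψ` is `(K ⊗ M)^~`. -/
def tildePullbackIso :
    tilde.functor A ⋙ Scheme.Modules.pullback (Spec.map ψ) ≅
      ModuleCat.extendScalars ψ.hom ⋙ tilde.functor K :=
  -- Both sides are left adjoints, and `pushforwardCompΓIso` identifies their right adjoints.
  ((conjugateIsoEquiv
    ((tilde.adjunction (R := A)).comp (Scheme.Modules.pullbackPushforwardAdjunction (Spec.map ψ)))
    ((ModuleCat.extendRestrictScalarsAdj ψ.hom).comp (tilde.adjunction (R := K)))).symm
    (pushforwardCompΓIso ψ)).symm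

/-- The functor sending a module `E` to its fiber `Γ(Spec K, g^* E)` at a `K`-valued point `g`. -/
def fiberFunctor {X : Scheme.{u}} (g : Spec K ⟶ X) : X.Modules ⥤ ModuleCat.{u} K :=
  Scheme.Modules.pullback g ⋙ moduleSpecΓFunctor (R := K)

variable {X : Scheme.{u}} (j : Spec A ⟶ X) [IsOpenImmersion j] {g : Spec K ⟶ X}
  (hg : Spec.map ψ ≫ j = g)

/-- The sections over an affine open, as a module. -/
def affineSections : X.Modules ⥤ ModuleCat.{u} A :=
  Scheme.Modules.restrictFunctor j ⋙ moduleSpecΓFunctor (R := A)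

/-- The comparison between the base change of the sections of a module over an affine open and
the fiber. -/
def fiberComparison : affineSections j ⋙ ModuleCat.extendScalars ψ.hom ⟶ fiberFunctor g where
  app E := tilde.toTildeΓNatIso.hom.app _ ≫
    (moduleSpecΓFunctor (R := K)).map ((tildePullbackIso ψ).inv.app _ ≫
      (Scheme.Modules.pullback (Spec.map ψ)).map
        (Scheme.Modules.fromTildeΓNatTrans.app (E.restrict j) ≫
          (Scheme.Modules.restrictFunctorIsoPullback j).hom.app E) ≫
      (Scheme.Modules.pullbackComp (Spec.map ψ) j).hom.app E ≫
      (Scheme.Modules.pullbackCongr hg).hom.app E)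
  naturality E F φ := by
    dsimp only [Functor.comp_map, fiberFunctor, affineSections, Functor.comp_obj]
    rw [Category.assoc, ← Functor.map_comp]
    rw [← Category.assoc, ← Functor.id_map ((ModuleCat.extendScalars ψ.hom).map _),
      tilde.toTildeΓNatIso.hom.naturality, Category.assoc, Functor.comp_map, ← Functor.map_comp]
    congr 2
    have h1 := (tildePullbackIso ψ).inv.naturality
      ((moduleSpecΓFunctor (R := A)).map ((Scheme.Modules.restrictFunctor j).map φ))
    have h2 := Scheme.Modules.fromTildeΓNatTrans.naturality ((Scheme.Modules.restrictFunctor j).map φ)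
    have h3 := (Scheme.Modules.restrictFunctorIsoPullback j).hom.naturality φ
    have h4 := (Scheme.Modules.pullbackComp (Spec.map ψ) j).hom.naturality φ
    have h5 := (Scheme.Modules.pullbackCongr hg).hom.naturality φ
    simp only [Functor.comp_map, Functor.id_map] at h1 h2 h3 h4 h5
    simp only [Category.assoc]
    rw [reassoc_of% h1, ← h5, ← reassoc_of% h4]
    simp only [← Functor.map_comp_assoc, Category.assoc]
    rw [← h3, reassoc_of% h2]

/-- The only factor of the comparison that can fail to be invertible is the counit `fromTildeΓ` on
the affine open, and it is an isomorphism for quasi-coherent modules. -/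
instance isIso_fiberComparison_app (E : X.Modules) [E.IsQuasicoherent] :
    IsIso ((fiberComparison ψ j hg).app E) := by
  have : IsIso (Scheme.Modules.fromTildeΓNatTrans.app (E.restrict j)) :=
    have := Scheme.Modules.isQuasicoherent_restrictFunctor j E
    Scheme.Modules.isIso_fromTildeΓ_of_isQuasicoherent (E.restrict j)
  have h1 : IsIso (tilde.toTildeΓNatIso.hom.app ((ModuleCat.extendScalars ψ.hom).obj
    ((affineSections j).obj E))) := inferInstance
  have h2 : IsIso ((tildePullbackIso ψ).inv.app ((affineSections j).obj E)) := inferInstance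
  have h3 : IsIso ((Scheme.Modules.pullbackComp (Spec.map ψ) j).hom.app E ≫
    (Scheme.Modules.pullbackCongr hg).hom.app E) := inferInstance
  have h4 : IsIso (Scheme.Modules.fromTildeΓNatTrans.app (E.restrict j) ≫
          (Scheme.Modules.restrictFunctorIsoPullback j).hom.app E) := IsIso.comp_isIso
  have h5 := @IsIso.comp_isIso _ _ _ _ _ _ _
    (@Functor.map_isIso _ _ _ _ _ _ (Scheme.Modules.pullback (Spec.map ψ)) _ h4) h3
  have h6 := @IsIso.comp_isIso _ _ _ _ _ _ _ h2 h5
  exact @IsIso.comp_isIso _ _ _ _ _ _ _ h1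
    (@Functor.map_isIso _ _ _ _ _ _ (moduleSpecΓFunctor (R := K)) _ h6)

end PullbackTilde

end

noncomputable section

/-! ### Sections over affine opens and their localizations. -/

section Sections

variable {X : Scheme.{u}} {U : X.Opens} (hU : IsAffineOpen U)

/-- Sections on the spectrum carry the action of `Γ(X, U)` through `ΓSpecIso`. This identity matches
that action with restriction of functions on `X`, which makes `sectionsEquiv` linear. -/
lemma fromSpec_appIso_inv (W : (Spec Γ(X, U)).Opens) (h : hU.fromSpec ''ᵁ W ≤ U)
    (r : Γ(X, U)) :
    (hU.fromSpec.appIso W).inv ((Spec Γ(X, U)).presheaf.map W.leTop.op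
      ((Scheme.ΓSpecIso Γ(X, U)).inv r)) = X.presheaf.map (homOfLE h).op r := by
  have h1 : W ≤ hU.fromSpec ⁻¹ᵁ U := by
    rw [hU.fromSpec_preimage_self]; exact le_top
  have h2 := Scheme.Hom.appLE_appIso_inv hU.fromSpec (U := U) (V := W) h1
  have h3 : hU.fromSpec.appLE U W h1 =
      (Scheme.ΓSpecIso Γ(X, U)).inv ≫ (Spec Γ(X, U)).presheaf.map W.leTop.op := by
    rw [Scheme.Hom.appLE, hU.fromSpec_app_self, Category.assoc, ← Functor.map_comp]
    rfl
  rw [h3] at h2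
  exact ConcreteCategory.congr_hom h2 r

/-- The sections of a module over an open subset of an affine open `U`, as sections of the
restriction to `Spec Γ(X, U)`. -/
def sectionsEquiv (E : X.Modules) (W : (Spec Γ(X, U)).Opens) (V : X.Opens)
    (h : hU.fromSpec ''ᵁ W = V) : Γ(E, V) ≃+ Γ(E.restrict hU.fromSpec, W) :=
  (E.presheaf.mapIso (eqToIso h).op ≪≫ (E.restrictAppIso hU.fromSpec W).symm
    ).addCommGroupIsoToAddEquiv

lemma sectionsEquiv_smul (E : X.Modules) (W : (Spec Γ(X, U)).Opens) (V : X.Opens)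
    (h : hU.fromSpec ''ᵁ W = V) (hVU : V ≤ U) (r : Γ(X, U)) (x : Γ(E, V)) :
    sectionsEquiv hU E W V h (X.presheaf.map (homOfLE hVU).op r • x) =
      r • sectionsEquiv hU E W V h x := by
  subst h
  rw [Scheme.Modules.smul_Spec_def, ← fromSpec_appIso_inv hU W hVU]
  simp [sectionsEquiv]

lemma sectionsEquiv_naturality {E F : X.Modules} (φ : E ⟶ F) (W : (Spec Γ(X, U)).Opens)
    (V : X.Opens) (h : hU.fromSpec ''ᵁ W = V) (x : Γ(E, V)) :
    sectionsEquiv hU F W V h (φ.app V x) =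
      ((Scheme.Modules.restrictFunctor hU.fromSpec).map φ).app W (sectionsEquiv hU E W V h x) := by
  subst h
  simp [sectionsEquiv]
  rfl

lemma sectionsEquiv_map (E : X.Modules) {W W' : (Spec Γ(X, U)).Opens} {V V' : X.Opens}
    (h : hU.fromSpec ''ᵁ W = V) (h' : hU.fromSpec ''ᵁ W' = V') (hW : W' ≤ W) (hV : V' ≤ V)
    (x : Γ(E, V)) :
    sectionsEquiv hU E W' V' h' (E.presheaf.map (homOfLE hV).op x) =
      (E.restrict hU.fromSpec).presheaf.map (homOfLE hW).op (sectionsEquiv hU E W V h x) := by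
  subst h h'
  simp [sectionsEquiv]

/-- The linear map on sections of a morphism of modules. -/
def appLinear {E H : X.Modules} (φ : E ⟶ H) (U : X.Opens) : Γ(E, U) →ₗ[Γ(X, U)] Γ(H, U) where
  toFun x := φ.app U x
  map_add' := map_add _
  map_smul' r x := φ.app_smul r x

/-- Sections over an affine open as sections of the restriction to the spectrum. -/
def affineSectionsEquiv (E : X.Modules) :
    Γ(E, U) ≃ₗ[Γ(X, U)] (affineSections hU.fromSpec).obj E where
  __ := sectionsEquiv hU E ⊤ U (by simp)
  map_smul' r x := by
    have := sectionsEquiv_smul hU E ⊤ U (by simp) le_rfl r x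
    simp only [homOfLE_refl, op_id, CategoryTheory.Functor.map_id, CommRingCat.id_apply] at this
    exact this

lemma affineSectionsEquiv_naturality {E F : X.Modules} (φ : E ⟶ F) (x : Γ(E, U)) :
    affineSectionsEquiv hU F (appLinear φ U x) =
      (affineSections hU.fromSpec).map φ (affineSectionsEquiv hU E x) :=
  sectionsEquiv_naturality hU φ ⊤ U (by simp) x

instance moduleBasicOpen (E : X.Modules) (f : Γ(X, U)) : Module Γ(X, U) Γ(E, X.basicOpen f) :=
  Module.compHom _ (algebraMap Γ(X, U) Γ(X, X.basicOpen f))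

instance (E : X.Modules) (f : Γ(X, U)) :
    IsScalarTower Γ(X, U) Γ(X, X.basicOpen f) Γ(E, X.basicOpen f) :=
  IsScalarTower.of_compHom _ _ _

/-- Restriction of sections to a basic open. -/
def restrictBasicOpen (E : X.Modules) (f : Γ(X, U)) :
    Γ(E, U) →ₗ[Γ(X, U)] Γ(E, X.basicOpen f) where
  toFun x := E.presheaf.map (homOfLE (X.basicOpen_le f)).op x
  map_add' := map_add _
  map_smul' r x := E.map_smul (homOfLE (X.basicOpen_le f)) r x

/-- Sections of a quasi-coherent module over a basic open of an affine open are the localization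
of the sections over the affine open. -/
theorem isLocalizedModule_restrictBasicOpen (hU : IsAffineOpen U) (E : X.Modules)
    [E.IsQuasicoherent] (f : Γ(X, U)) :
    IsLocalizedModule (Submonoid.powers f) (restrictBasicOpen E f) := by
  have := Scheme.Modules.isQuasicoherent_restrictFunctor hU.fromSpec E
  have hloc := (isIso_fromTildeΓ_iff_isLocalizing _).1
    (Scheme.Modules.isIso_fromTildeΓ_of_isQuasicoherent (E.restrict hU.fromSpec)) f
  let ε : Γ(E, X.basicOpen f) ≃ₗ[Γ(X, U)]
      ((modulesSpecToSheaf.obj (E.restrict hU.fromSpec)).obj.obj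
        (.op (PrimeSpectrum.basicOpen f))) :=
    { __ := sectionsEquiv hU E (PrimeSpectrum.basicOpen f) (X.basicOpen f)
        (hU.fromSpec_image_basicOpen f)
      map_smul' := fun r x => sectionsEquiv_smul hU E _ _ (hU.fromSpec_image_basicOpen f)
        (X.basicOpen_le f) r x }
  have h1 := IsLocalizedModule.of_linearEquiv_right (Submonoid.powers f) _
    (affineSectionsEquiv hU E) (hf := hloc)
  have h2 := IsLocalizedModule.of_linearEquiv (Submonoid.powers f) _ ε.symm (hf := h1)
  convert h2 using 1
  ext x
  refine (ε.symm_apply_apply _).symm.trans (congrArg ε.symm ?_)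
  exact sectionsEquiv_map hU E _ _ le_top (X.basicOpen_le f) x

end Sections

end

/-! ### Pullbacks and sections of vector bundles, and the ideal sheaf of minors. -/

noncomputable section

/-- Finality of the preimage functor enters in the pullback of free modules. Each comma category is
connected because every object maps to the one given by `⊤`. -/
instance final_opensMap {X Y : Scheme.{u}} (f : X ⟶ Y) :
    (TopologicalSpace.Opens.map f.base).Final where
  out d := by
    let t : StructuredArrow d (TopologicalSpace.Opens.map f.base) :=
      StructuredArrow.mk (Y := (⊤ : Y.Opens)) (homOfLE (fun _ _ => trivial))
    have hs : ∀ s, Nonempty (s ⟶ t) := fun s =>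
      ⟨StructuredArrow.homMk (homOfLE le_top) (Subsingleton.elim _ _)⟩
    have : Nonempty (StructuredArrow d (TopologicalSpace.Opens.map f.base)) := ⟨t⟩
    exact zigzag_isConnected fun a b =>
      (Zigzag.of_hom (hs a).some).trans (Zigzag.of_inv (hs b).some)

/-- The pullback of a trivial bundle is trivial. -/
def pullbackTrivialBundleIso {X Y : Scheme.{u}} (f : X ⟶ Y) (d : ℕ) :
    (Scheme.Modules.pullback f).obj (trivialBundle Y d) ≅ trivialBundle X d :=
  have : (SheafOfModules.pushforward.{u} f.toRingCatSheafHom).IsRightAdjoint :=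
    (Scheme.Modules.pullbackPushforwardAdjunction f).isRightAdjoint
  SheafOfModules.pullbackObjFreeIso f.toRingCatSheafHom _

/-- A module that is trivial on `U` becomes trivial after pullback along a morphism that factors
through `U`. -/
lemma nonempty_pullback_iso_trivialBundle {X T : Scheme.{u}} {E : X.Modules} {U : X.Opens} {d : ℕ}
    (h : Nonempty (E.restrict U.ι ≅ trivialBundle (U : Scheme.{u}) d)) (g : T ⟶ X)
    (hg : Set.range g ⊆ U) :
    Nonempty ((Scheme.Modules.pullback g).obj E ≅ trivialBundle T d) := by
  obtain ⟨e⟩ := h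
  have hr : Set.range g ⊆ Set.range U.ι := by simpa using hg
  let g' := IsOpenImmersion.lift U.ι g hr
  have hg' : g' ≫ U.ι = g := IsOpenImmersion.lift_fac _ _ _
  exact ⟨((Scheme.Modules.pullbackCongr hg').app E).symm ≪≫
    ((Scheme.Modules.pullbackComp g' U.ι).app E).symm ≪≫
    (Scheme.Modules.pullback g').mapIso
      (((Scheme.Modules.restrictFunctorIsoPullback U.ι).app E).symm ≪≫ e) ≪≫
    pullbackTrivialBundleIso g' d⟩

lemma IsFiniteLocallyFree.of_iso {X : Scheme.{u}} {E F : X.Modules} (hE : IsFiniteLocallyFree E)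
    (e : E ≅ F) : IsFiniteLocallyFree F := fun x => by
  obtain ⟨U, d, hxU, ⟨i⟩⟩ := hE x
  exact ⟨U, d, hxU, ⟨(Scheme.Modules.restrictFunctor U.ι).mapIso e.symm ≪≫ i⟩⟩

lemma IsVectorBundle.isFiniteLocallyFree {X : Scheme.{u}} {E : X.Modules} {d : ℕ}
    (hE : IsVectorBundle E d) : IsFiniteLocallyFree E := fun x => by
  obtain ⟨U, hxU, h⟩ := hE x
  exact ⟨U, d, hxU, h⟩

lemma restrict_pullback_iso_trivialBundle {X T : Scheme.{u}} {E : X.Modules} {U : X.Opens} {d : ℕ}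
    (h : Nonempty (E.restrict U.ι ≅ trivialBundle (U : Scheme.{u}) d)) (g : T ⟶ X) :
    Nonempty (((Scheme.Modules.pullback g).obj E).restrict (g ⁻¹ᵁ U).ι ≅
      trivialBundle ((g ⁻¹ᵁ U : T.Opens) : Scheme.{u}) d) := by
  obtain ⟨e⟩ := nonempty_pullback_iso_trivialBundle h ((g ⁻¹ᵁ U).ι ≫ g) (by
    rintro _ ⟨x, rfl⟩
    exact x.2)
  exact ⟨(Scheme.Modules.restrictFunctorIsoPullback _).app _ ≪≫
    (Scheme.Modules.pullbackComp _ g).app E ≪≫ e⟩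

lemma IsFiniteLocallyFree.pullback {X T : Scheme.{u}} {E : X.Modules}
    (hE : IsFiniteLocallyFree E) (g : T ⟶ X) :
    IsFiniteLocallyFree ((Scheme.Modules.pullback g).obj E) := fun t => by
  obtain ⟨U, d, hxU, h⟩ := hE (g t)
  exact ⟨g ⁻¹ᵁ U, d, hxU, restrict_pullback_iso_trivialBundle h g⟩

lemma IsVectorBundle.pullback {X T : Scheme.{u}} {E : X.Modules} {d : ℕ}
    (hE : IsVectorBundle E d) (g : T ⟶ X) :
    IsVectorBundle ((Scheme.Modules.pullback g).obj E) d := fun t => by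
  obtain ⟨U, hxU, h⟩ := hE (g t)
  exact ⟨g ⁻¹ᵁ U, hxU, restrict_pullback_iso_trivialBundle h g⟩

/-- The global sections of the trivial bundle of rank `d` over an affine scheme. -/
def ΓTrivialBundleIso (A : CommRingCat.{u}) (d : ℕ) :
    (moduleSpecΓFunctor (R := A)).obj (trivialBundle (Spec A) d) ≅
      ModuleCat.of A (ULift.{u} (Fin d) →₀ A) :=
  (moduleSpecΓFunctor (R := A)).mapIso (tildeFinsupp (R := A) (ULift.{u} (Fin d))).symm ≪≫
    (tilde.toTildeΓNatIso.app _).symm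

/-- Over an affine open on which a module is trivial, its sections form a free module. -/
lemma nonempty_affineSections_equiv {X : Scheme.{u}} {E : X.Modules} {V : X.Opens} {d : ℕ}
    (h : Nonempty (E.restrict V.ι ≅ trivialBundle (V : Scheme.{u}) d)) {A : CommRingCat.{u}}
    (j : Spec A ⟶ X) [IsOpenImmersion j] (hj : Set.range j ⊆ V) :
    Nonempty ((affineSections j).obj E ≃ₗ[A] (Fin d → A)) := by
  obtain ⟨e⟩ := nonempty_pullback_iso_trivialBundle h j hj
  let i : (affineSections j).obj E ≅ ModuleCat.of A (ULift.{u} (Fin d) →₀ A) :=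
    (moduleSpecΓFunctor (R := A)).mapIso
      ((Scheme.Modules.restrictFunctorIsoPullback j).app E ≪≫ e) ≪≫ ΓTrivialBundleIso A d
  exact ⟨i.toLinearEquiv ≪≫ₗ Finsupp.linearEquivFunOnFinite _ _ _ ≪≫ₗ
    LinearEquiv.funCongrLeft _ _ Equiv.ulift.symm⟩

lemma nonempty_sections_equiv {X : Scheme.{u}} {E : X.Modules} {V : X.Opens} {d : ℕ}
    (h : Nonempty (E.restrict V.ι ≅ trivialBundle (V : Scheme.{u}) d)) {U : X.Opens}
    (hU : IsAffineOpen U) (hUV : U ≤ V) :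
    Nonempty (Γ(E, U) ≃ₗ[Γ(X, U)] (Fin d → Γ(X, U))) := by
  obtain ⟨e⟩ := nonempty_affineSections_equiv h hU.fromSpec (by
    rw [hU.range_fromSpec]; exact hUV)
  exact ⟨affineSectionsEquiv hU E ≪≫ₗ e⟩

/-- The sections of a finite locally free module over an affine open are finitely presented. -/
theorem IsFiniteLocallyFree.finitePresentation {X : Scheme.{u}} {E : X.Modules}
    (hE : IsFiniteLocallyFree E) {U : X.Opens} (hU : IsAffineOpen U) :
    Module.FinitePresentation Γ(X, U) Γ(E, U) := by
  have := hE.isQuasicoherent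
  let t : Set Γ(X, U) :=
    {f | Module.FinitePresentation Γ(X, X.basicOpen f) Γ(E, X.basicOpen f)}
  -- Every point of `U` has a basic open neighbourhood inside an open set trivializing `E`, and
  -- there the sections are free of finite rank.
  have ht : Ideal.span t = ⊤ := by
    rw [← hU.self_le_iSup_basicOpen_iff]
    intro x hx
    obtain ⟨V, d, hxV, hV⟩ := hE x
    obtain ⟨f, hf, hxf⟩ := hU.exists_basicOpen_le ⟨x, hxV⟩ hx
    obtain ⟨e⟩ := nonempty_sections_equiv hV (hU.basicOpen f) hf
    refine TopologicalSpace.Opens.mem_iSup.2 ⟨⟨f, ?_⟩, hxf⟩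
    exact Module.FinitePresentation.of_equiv e.symm
  have : ∀ g : t, IsLocalization.Away g.val Γ(X, X.basicOpen g.val) := fun g =>
    hU.isLocalization_basicOpen g.val
  have : ∀ g : t, IsLocalizedModule (Submonoid.powers g.val) (restrictBasicOpen E g.val) := fun g =>
    isLocalizedModule_restrictBasicOpen hU E g.val
  exact finitePresentation_of_localizationSpan t ht (Rₚ := fun g => Γ(X, X.basicOpen g.val))
    (fun g => restrictBasicOpen E g.val) fun g => g.2

/-- The ideals of minors of a morphism of finite locally free modules form an ideal sheaf. -/
theorem rankLEIdeal_ideal {X : Scheme.{u}} {E H : X.Modules} (hE : IsFiniteLocallyFree E)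
    (hH : IsFiniteLocallyFree H) (φ : E ⟶ H) (k : ℕ) (U : X.affineOpens) :
    (rankLEIdeal φ k).ideal U = minorIdeal φ (k + 1) U.1 := by
  have := hE.isQuasicoherent
  have := hH.isQuasicoherent
  -- The ideals of minors are already compatible with restriction to basic opens, so they form an
  -- ideal sheaf, which `ofIdeals` leaves unchanged.
  let J : X.IdealSheafData :=
    { ideal := fun U => minorIdeal φ (k + 1) U.1
      map_ideal_basicOpen := fun U f => by
        have := hH.finitePresentation U.2
        have := isLocalizedModule_restrictBasicOpen U.2 E f
        have := isLocalizedModule_restrictBasicOpen U.2 H f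
        have := U.2.isLocalization_basicOpen f
        refine map_linearMinorIdeal (Submonoid.powers f) (restrictBasicOpen E f)
          (restrictBasicOpen H f) (appLinear φ U.1) (appLinear φ (X.basicOpen f)) (fun x => ?_)
          (k + 1)
        exact (ConcreteCategory.congr_hom
          (φ.mapPresheaf.naturality (homOfLE (X.basicOpen_le f)).op) x) }
  exact congrFun (congrArg Scheme.IdealSheafData.ideal (Scheme.IdealSheafData.ofIdeals_ideal J)) U

end

/-! ### Rank loci at field-valued points. -/

noncomputable section

/-- The ranks of two linear maps that correspond to each other under linear equivalences agree. -/
lemma finrank_range_eq_of_equiv {K V V' W W' : Type*} [Field K] [AddCommGroup V] [Module K V]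
    [AddCommGroup V'] [Module K V'] [AddCommGroup W] [Module K W] [AddCommGroup W'] [Module K W']
    (f : V →ₗ[K] W) (f' : V' →ₗ[K] W') (e : V ≃ₗ[K] V') (e' : W ≃ₗ[K] W')
    (h : ∀ x, e' (f x) = f' (e x)) :
    Module.finrank K (LinearMap.range f) = Module.finrank K (LinearMap.range f') := by
  have h1 : e'.toLinearMap ∘ₗ f = f' ∘ₗ e.toLinearMap := LinearMap.ext h
  have h2 : (LinearMap.range f).map e'.toLinearMap = LinearMap.range f' := by
    rw [← LinearMap.range_comp, h1, LinearMap.range_comp_of_range_eq_top _ e.range]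
  rw [← h2]
  exact (e'.submoduleMap _).finrank_eq

/-- Isomorphic morphisms of vector spaces have the same rank. -/
lemma finrank_range_eq_of_iso {K : Type u} [Field K] {V V' W W' : ModuleCat.{u} K} (f : V ⟶ W)
    (f' : V' ⟶ W') (e : V ≅ V') (e' : W ≅ W') (h : f ≫ e'.hom = e.hom ≫ f') :
    Module.finrank K (LinearMap.range f.hom) = Module.finrank K (LinearMap.range f'.hom) :=
  finrank_range_eq_of_equiv f.hom f'.hom e.toLinearEquiv e'.toLinearEquiv fun x =>
    ConcreteCategory.congr_hom h x

section Field

variable {K : Type u} [Field K]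

instance : Unique (Spec (CommRingCat.of K)) :=
  inferInstanceAs (Unique (PrimeSpectrum K))

variable {X : Scheme.{u}} (g : Spec (.of K) ⟶ X)

lemma range_subset_of_mem {U : X.Opens} {y : Spec (.of K)} (h : g y ∈ U) : Set.range g ⊆ U := by
  rintro _ ⟨z, rfl⟩
  rwa [Subsingleton.elim z y]

lemma fiber_equiv_of_restrict_iso {E : X.Modules} {U : X.Opens} {d : ℕ}
    (h : Nonempty (E.restrict U.ι ≅ trivialBundle (U : Scheme.{u}) d))
    (hg : Set.range g ⊆ U) : Nonempty ((fiberFunctor g).obj E ≃ₗ[K] (Fin d → K)) := by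
  obtain ⟨e⟩ := nonempty_pullback_iso_trivialBundle h g hg
  let i : (fiberFunctor g).obj E ≅ ModuleCat.of K (ULift.{u} (Fin d) →₀ K) :=
    (moduleSpecΓFunctor (R := .of K)).mapIso e ≪≫ ΓTrivialBundleIso (.of K) d
  exact ⟨i.toLinearEquiv ≪≫ₗ Finsupp.linearEquivFunOnFinite _ _ _ ≪≫ₗ
    LinearEquiv.funCongrLeft _ _ Equiv.ulift.symm⟩

lemma IsFiniteLocallyFree.finite_fiber {E : X.Modules} (hE : IsFiniteLocallyFree E) :
    Module.Finite K ((fiberFunctor g).obj E) := by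
  obtain ⟨U, d, hxU, h⟩ := hE (g default)
  obtain ⟨e⟩ := fiber_equiv_of_restrict_iso g h (range_subset_of_mem g hxU)
  exact Module.Finite.equiv e.symm

lemma IsVectorBundle.finrank_fiber {E : X.Modules} {d : ℕ} (hE : IsVectorBundle E d) :
    Module.finrank K ((fiberFunctor g).obj E) = d := by
  obtain ⟨U, hxU, h⟩ := hE (g default)
  obtain ⟨e⟩ := fiber_equiv_of_restrict_iso g h (range_subset_of_mem g hxU)
  rw [e.finrank_eq, Module.finrank_fin_fun]

/-- The only prime of `K` is zero, so the prime of the image point is the kernel of `ψ`. -/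
lemma mem_basicOpen_iff {U : X.Opens} (hU : IsAffineOpen U) (ψ : Γ(X, U) ⟶ .of K)
    (hg : Spec.map ψ ≫ hU.fromSpec = g) (y) (f : Γ(X, U)) :
    g y ∈ X.basicOpen f ↔ ψ f ≠ 0 := by
  subst hg
  have h1 : (Spec.map ψ ≫ hU.fromSpec) y ∈ X.basicOpen f ↔
      Spec.map ψ y ∈ hU.fromSpec ⁻¹ᵁ X.basicOpen f := Iff.rfl
  rw [h1, hU.fromSpec_preimage_basicOpen]
  have h2 : (show PrimeSpectrum K from y).asIdeal = ⊥ := by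
    rw [Subsingleton.elim (show PrimeSpectrum K from y) ⊥]; rfl
  change ¬ (ψ f ∈ (show PrimeSpectrum K from y).asIdeal) ↔ _
  rw [h2, Ideal.mem_bot]

/-- A `K`-valued point whose image lies in an affine open comes from a ring homomorphism. -/
lemma exists_specMap_fromSpec {U : X.Opens} (hU : IsAffineOpen U) (hg : Set.range g ⊆ U) :
    ∃ ψ : Γ(X, U) ⟶ .of K, Spec.map ψ ≫ hU.fromSpec = g :=
  ⟨Spec.preimage (IsOpenImmersion.lift hU.fromSpec g (by rwa [hU.range_fromSpec])), by
    rw [Spec.map_preimage, IsOpenImmersion.lift_fac]⟩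

lemma finrank_range_extendScalars {A : CommRingCat.{u}} (ψ : A ⟶ .of K) {M N : ModuleCat.{u} A}
    (f : M ⟶ N) [Module.Finite A M] [Module.Free A N] [Module.Finite A N] (n : ℕ) :
    Module.finrank K (LinearMap.range ((ModuleCat.extendScalars ψ.hom).map f).hom) ≤ n ↔
      ∀ (e : Fin (n + 1) → M) (θ : Fin (n + 1) → N →ₗ[A] A),
        ψ (Matrix.of fun a b => θ a (f (e b))).det = 0 := by
  let := ψ.hom.toAlgebra
  exact finrank_range_baseChange_le_iff (k := K) f.hom n

/-- The rank locus of a morphism of finite locally free modules is detected by the rank of the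
morphism on the fibers at field-valued points. -/
theorem mem_support_rankLEIdeal_iff {E H : X.Modules} (hE : IsFiniteLocallyFree E)
    (hH : IsFiniteLocallyFree H) (φ : E ⟶ H) (k : ℕ) (y) :
    g y ∈ (rankLEIdeal φ k).support ↔
      Module.finrank K (LinearMap.range ((fiberFunctor g).map φ).hom) ≤ k := by
  have := hE.isQuasicoherent
  have := hH.isQuasicoherent
  obtain ⟨V₁, d₁, hx₁, h₁⟩ := hE (g y)
  obtain ⟨V₂, d₂, hx₂, h₂⟩ := hH (g y)
  obtain ⟨U, hU, hxU, hUV⟩ := exists_isAffineOpen_mem_and_subset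
    (x := g y) (U := V₁ ⊓ V₂) ⟨hx₁, hx₂⟩
  obtain ⟨ψ, hψ⟩ := exists_specMap_fromSpec g hU (range_subset_of_mem g hxU)
  obtain ⟨e₁⟩ := nonempty_sections_equiv h₁ hU (hUV.trans inf_le_left)
  obtain ⟨e₂⟩ := nonempty_sections_equiv h₂ hU (hUV.trans inf_le_right)
  let ε₁ := affineSectionsEquiv hU E
  let ε₂ := affineSectionsEquiv hU H
  have : Module.Finite Γ(X, U) ((affineSections hU.fromSpec).obj E) :=
    Module.Finite.equiv (e₁.symm ≪≫ₗ ε₁)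
  have : Module.Free Γ(X, U) ((affineSections hU.fromSpec).obj H) :=
    Module.Free.of_equiv (e₂.symm ≪≫ₗ ε₂)
  have : Module.Finite Γ(X, U) ((affineSections hU.fromSpec).obj H) :=
    Module.Finite.equiv (e₂.symm ≪≫ₗ ε₂)
  have i₁ := isIso_fiberComparison_app ψ hU.fromSpec hψ E
  have i₂ := isIso_fiberComparison_app ψ hU.fromSpec hψ H
  -- On an affine neighbourhood trivializing both modules, the fiber map is the base change along
  -- `ψ` of the map on sections.
  have hrank := finrank_range_eq_of_iso ((ModuleCat.extendScalars ψ.hom).map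
      ((affineSections hU.fromSpec).map φ)) ((fiberFunctor g).map φ)
      (@asIso _ _ _ _ _ i₁) (@asIso _ _ _ _ _ i₂)
      ((fiberComparison ψ hU.fromSpec hψ).naturality φ)
  -- The point lies in the support exactly when `ψ` kills every minor over `U`, which is the
  -- criterion for the rank after base change.
  rw [Scheme.IdealSheafData.mem_support_iff_of_mem (U := ⟨U, hU⟩) hxU,
    rankLEIdeal_ideal hE hH, Scheme.mem_zeroLocus_iff, ← hrank, finrank_range_extendScalars]
  simp only [mem_basicOpen_iff g hU ψ hψ, not_not]
  have hspan : (∀ f ∈ minorIdeal φ (k + 1) U, ψ f = 0) ↔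
      minorIdeal φ (k + 1) U ≤ RingHom.ker ψ.hom := Iff.rfl
  change (∀ f ∈ minorIdeal φ (k + 1) U, ψ f = 0) ↔ _
  rw [hspan, minorIdeal, Ideal.span_le]
  constructor
  · intro h e θ
    refine Eq.trans ?_ (RingHom.mem_ker.1
      (h ⟨fun b => ε₁.symm (e b), fun a => θ a ∘ₗ ε₂.toLinearMap, rfl⟩))
    change ψ _ = ψ _
    congr 2
    ext a b
    simp only [Matrix.of_apply, LinearMap.comp_apply]
    congr 1
    refine Eq.trans ?_ (affineSectionsEquiv_naturality hU φ (ε₁.symm (e b))).symm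
    erw [LinearEquiv.apply_symm_apply]
  · rintro h _ ⟨e, θ, rfl⟩
    refine Eq.trans ?_ (h (fun b => ε₁ (e b)) (fun a => θ a ∘ₗ ε₂.symm.toLinearMap))
    change ψ _ = ψ _
    congr 2
    ext a b
    simp only [Matrix.of_apply, LinearMap.comp_apply]
    congr 1
    refine Eq.trans ?_ (congrArg ε₂.symm (affineSectionsEquiv_naturality hU φ (e b)))
    exact (ε₂.symm_apply_apply _).symm

end Field

end

/-! ### Subbundles split on fibers. -/

noncomputable section

instance (A : CommRingCat.{u}) : (moduleSpecΓFunctor (R := A)).Additive where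
  map_add := rfl

instance {X Y : Scheme.{u}} (f : X ⟶ Y) [IsOpenImmersion f] :
    (Scheme.Modules.restrictFunctor f).Additive where
  map_add := rfl

instance additive_extendScalars {A K : CommRingCat.{u}} (ψ : A ⟶ K) :
    (ModuleCat.extendScalars.{u, u, u} ψ.hom).Additive :=
  have := (ModuleCat.extendRestrictScalarsAdj.{u, u, u} ψ.hom).isLeftAdjoint
  have := Limits.preservesBinaryBiproducts_of_preservesBinaryCoproducts
    (ModuleCat.extendScalars.{u, u, u} ψ.hom)
  Functor.additive_of_preservesBinaryBiproducts _

instance {A : CommRingCat.{u}} {X : Scheme.{u}} (j : Spec A ⟶ X) [IsOpenImmersion j] :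
    (affineSections j).Additive where
  map_add := rfl

instance additive_fiberFunctor {K : CommRingCat.{u}} {X : Scheme.{u}} (g : Spec K ⟶ X) :
    (fiberFunctor g).Additive where
  map_add {_ _ φ ψ} := congrArg (moduleSpecΓFunctor (R := K)).map
    ((Scheme.Modules.pullback g).map_add (f := φ) (g := ψ))

instance {K : Type u} [Field K] {X : Scheme.{u}} (g : Spec (.of K) ⟶ X) :
    (fiberFunctor g).Additive :=
  additive_fiberFunctor g

section Sections

/-- Sections over an open subset, as a functor. -/
def sectionsFunctor {X : Scheme.{u}} (U : X.Opens) : X.Modules ⥤ Ab.{u} :=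
  Scheme.Modules.toPresheaf X ⋙ (evaluation _ _).obj (.op U)

instance {X : Scheme.{u}} (U : X.Opens) : (sectionsFunctor U).Additive where
  map_add := rfl

instance {X : Scheme.{u}} (U : X.Opens) : PreservesFiniteLimits (sectionsFunctor U) where
  preservesFiniteLimits J _ _ :=
    have : HasLimitsOfShape J Ab.{u} := hasLimitsOfShape_of_hasFiniteLimits _ _
    have : PreservesLimitsOfShape J ((evaluation (X.Opens)ᵒᵖ Ab.{u}).obj (.op U)) := inferInstance
    comp_preservesLimitsOfShape _ _

variable {X : Scheme.{u}} {F E : X.Modules} (ι : F ⟶ E) [Mono ι]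

lemma app_injective_of_mono (U : X.Opens) : Function.Injective (ι.app U) := by
  have : Mono ((sectionsFunctor U).map ι) := inferInstance
  exact (AddCommGrpCat.mono_iff_injective _).1 this

/-- A monomorphism is the kernel of its cokernel, and taking sections is left exact. -/
lemma exists_app_eq_of_cokernel_eq_zero (U : X.Opens) (v : Γ(E, U))
    (h : (cokernel.π ι).app U v = 0) : ∃ w, ι.app U w = v := by
  have h1 := (ShortComplex.exact_cokernel ι).map_of_mono_of_preservesKernel
    (sectionsFunctor U) ‹_› inferInstance
  exact (ShortComplex.ab_exact_iff _).1 h1 v h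

end Sections

/-- An epimorphism of quasi-coherent modules is surjective on sections over affine opens. -/
lemma affineSections_surjective {X : Scheme.{u}} {E Q : X.Modules} [E.IsQuasicoherent]
    [Q.IsQuasicoherent] (p : E ⟶ Q) [Epi p] {A : CommRingCat.{u}} (j : Spec A ⟶ X)
    [IsOpenImmersion j] : Function.Surjective ((affineSections j).map p) := by
  have hE := Scheme.Modules.isQuasicoherent_restrictFunctor j E
  have hQ := Scheme.Modules.isQuasicoherent_restrictFunctor j Q
  have i₁ : IsIso (Scheme.Modules.fromTildeΓNatTrans.app (E.restrict j)) :=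
    Scheme.Modules.isIso_fromTildeΓ_of_isQuasicoherent (E.restrict j)
  have i₂ : IsIso (Scheme.Modules.fromTildeΓNatTrans.app (Q.restrict j)) :=
    Scheme.Modules.isIso_fromTildeΓ_of_isQuasicoherent (Q.restrict j)
  have h := Scheme.Modules.fromTildeΓNatTrans.naturality
    ((Scheme.Modules.restrictFunctor j).map p)
  rw [← IsIso.eq_comp_inv] at h
  -- Up to the invertible counits this is the restriction of `p` to `Spec A`, an epimorphism;
  -- `tilde` reflects epimorphisms.
  have h1 : Epi ((tilde.functor A).map ((affineSections j).map p)) := by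
    refine h ▸ ?_
    have : Epi ((Scheme.Modules.restrictFunctor j).map p) := inferInstance
    exact epi_comp' (epi_comp' i₁.epi_of_iso this) (@IsIso.epi_of_iso _ _ _ _ _
      (@IsIso.inv_isIso _ _ _ _ _ i₂))
  exact (ModuleCat.epi_iff_surjective _).1 ((tilde.functor A).epi_of_epi_map h1)

/-- The short complex `F ⟶ E ⟶ E / F`. -/
abbrev cokernelComplex {C : Type*} [Category C] [Abelian C] {F E : C} (ι : F ⟶ E) :
    ShortComplex C :=
  ShortComplex.mk ι (cokernel.π ι) (cokernel.condition ι)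

section Splitting

variable {X : Scheme.{u}} {F E : X.Modules} {ι : F ⟶ E} {r : ℕ}

/-- Over an affine open on which the quotient is trivial, a subbundle is a direct summand. -/
lemma nonempty_splitting_affineSections (hι : Mono ι) [E.IsQuasicoherent]
    [(cokernel ι).IsQuasicoherent] {A : CommRingCat.{u}} (j : Spec A ⟶ X) [IsOpenImmersion j]
    [Module.Projective A ((affineSections j).obj (cokernel ι))] :
    Nonempty ((cokernelComplex ι).map (affineSections j)).Splitting := by
  obtain ⟨s, hs⟩ := Module.projective_lifting_property (R := A)
    (P := (affineSections j).obj (cokernel ι)) (M := (affineSections j).obj E)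
    ((affineSections j).map (cokernel.π ι)).hom
    LinearMap.id (affineSections_surjective (cokernel.π ι) j)
  have hm : Mono ((affineSections j).map ι) :=
    (ModuleCat.mono_iff_injective _).2 (app_injective_of_mono ι (j ''ᵁ ⊤))
  refine ⟨.ofExactOfSection _ ?_ (ModuleCat.ofHom (R := A)
    (X := (affineSections j).obj (cokernel ι)) (Y := (affineSections j).obj E) s)
    ?_ hm⟩
  · rw [ShortComplex.moduleCat_exact_iff]
    exact exists_app_eq_of_cokernel_eq_zero ι (j ''ᵁ ⊤)
  · exact ModuleCat.hom_ext hs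

/-- The fiber of a subbundle at a field-valued point is a direct summand. -/
theorem IsSubbundle.nonempty_splitting_fiber (h : IsSubbundle ι r) (hE : IsFiniteLocallyFree E)
    {K : Type u} [Field K] (g : Spec (.of K) ⟶ X) :
    Nonempty ((cokernelComplex ι).map (fiberFunctor g)).Splitting := by
  have := hE.isQuasicoherent
  have := h.quotient.isQuasicoherent
  have := h.isVectorBundle.isFiniteLocallyFree.isQuasicoherent
  obtain ⟨V, d, hxV, hV⟩ := h.quotient (g default)
  obtain ⟨U, hU, hxU, hUV⟩ := exists_isAffineOpen_mem_and_subset hxV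
  obtain ⟨ψ, hψ⟩ := exists_specMap_fromSpec g hU (range_subset_of_mem g hxU)
  obtain ⟨e⟩ := nonempty_affineSections_equiv hV hU.fromSpec (by rwa [hU.range_fromSpec])
  have : Module.Free Γ(X, U) ((affineSections hU.fromSpec).obj (cokernel ι)) :=
    Module.Free.of_equiv e.symm
  -- A splitting, unlike left exactness, survives the additive functor of base change to `K`; hence
  -- the fiber of `F` still embeds in that of `E`.
  obtain ⟨s⟩ := nonempty_splitting_affineSections h.mono hU.fromSpec
  have i₁ := isIso_fiberComparison_app ψ hU.fromSpec hψ F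
  have i₂ := isIso_fiberComparison_app ψ hU.fromSpec hψ E
  have i₃ := isIso_fiberComparison_app ψ hU.fromSpec hψ (cokernel ι)
  exact ⟨(@ShortComplex.Splitting.map _ _ _ _ _ _ _ s (ModuleCat.extendScalars ψ.hom)
    (additive_extendScalars ψ)).ofIso
    (ShortComplex.isoMk (@asIso _ _ _ _ _ i₁) (@asIso _ _ _ _ _ i₂) (@asIso _ _ _ _ _ i₃)
      ((fiberComparison ψ hU.fromSpec hψ).naturality ι).symm
      ((fiberComparison ψ hU.fromSpec hψ).naturality (cokernel.π ι)).symm)⟩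

end Splitting

end

/-! ### Modules on affine schemes and on spectra of fields. -/

noncomputable section

/-- A linear map between bundled modules, as a morphism. -/
def homOfLinear {R : Type u} [Ring R] {M N : ModuleCat.{u} R} (f : M →ₗ[R] N) : M ⟶ N :=
  ModuleCat.ofHom f

section Affine

variable (A : CommRingCat.{u})

/-- The global sections of a module on an affine scheme. -/
def ΓFunctor : (Spec A).Modules ⥤ ModuleCat.{u} A := moduleSpecΓFunctor (R := A)

/-- The module on an affine scheme associated with a module. -/
def tildeFunctor : ModuleCat.{u} A ⥤ (Spec A).Modules := tilde.functor A

/-- The module associated with the global sections of `M` maps to `M`. -/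
def tildeCounit : ΓFunctor A ⋙ tildeFunctor A ⟶ 𝟭 (Spec A).Modules :=
  Scheme.Modules.fromTildeΓNatTrans (R := A)

/-- The global sections of the module associated with a module. -/
def tildeUnitIso : 𝟭 (ModuleCat.{u} A) ≅ tildeFunctor A ⋙ ΓFunctor A := tilde.toTildeΓNatIso

instance (M : (Spec A).Modules) [M.IsQuasicoherent] : IsIso ((tildeCounit A).app M) :=
  Scheme.Modules.isIso_fromTildeΓ_of_isQuasicoherent (R := A) M

instance (M : ModuleCat.{u} A) : ((tildeFunctor A).obj M).IsQuasicoherent :=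
  inferInstanceAs (((tilde.functor A).obj M).IsQuasicoherent)

instance : (tildeFunctor A).IsLeftAdjoint := inferInstanceAs (tilde.functor A).IsLeftAdjoint

instance : (tildeFunctor A).Additive := inferInstanceAs (tilde.functor A).Additive

/-- The module associated with a free module is trivial. -/
def tildeFunctorFreeIso (d : ℕ) :
    (tildeFunctor A).obj (ModuleCat.of A (ULift.{u} (Fin d) →₀ A)) ≅ trivialBundle (Spec A) d :=
  tildeFinsupp (R := A) _

lemma Γ_triangle (M : (Spec A).Modules) :
    (tildeUnitIso A).hom.app ((ΓFunctor A).obj M) ≫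
      (ΓFunctor A).map ((tildeCounit A).app M) = 𝟙 _ :=
  (tilde.adjunction (R := A)).right_triangle_components M

variable {A} {F F' M : (Spec A).Modules}

lemma tildeCounit_naturality (j : F ⟶ M) :
    (tildeFunctor A).map ((ΓFunctor A).map j) ≫ (tildeCounit A).app M =
      (tildeCounit A).app F ≫ j :=
  (tildeCounit A).naturality j

/-- Morphisms of quasi-coherent modules on an affine scheme can be lifted along a
morphism if this is possible on global sections. -/
lemma exists_lift_of_Γ [F.IsQuasicoherent] (j : F ⟶ M) (j' : F' ⟶ M)
    (l : (ΓFunctor A).obj F ⟶ (ΓFunctor A).obj F')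
    (hl : l ≫ (ΓFunctor A).map j' = (ΓFunctor A).map j) : ∃ a : F ⟶ F', a ≫ j' = j := by
  refine ⟨inv ((tildeCounit A).app F) ≫ (tildeFunctor A).map l ≫ (tildeCounit A).app F', ?_⟩
  rw [Category.assoc, Category.assoc, ← tildeCounit_naturality, ← Functor.map_comp_assoc, hl,
    tildeCounit_naturality, IsIso.inv_hom_id_assoc]

lemma isSplitMono_of_Γ [F.IsQuasicoherent] [M.IsQuasicoherent] (j : F ⟶ M)
    (l : (ΓFunctor A).obj M ⟶ (ΓFunctor A).obj F) (hl : (ΓFunctor A).map j ≫ l = 𝟙 _) :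
    IsSplitMono j := by
  refine ⟨⟨inv ((tildeCounit A).app M) ≫ (tildeFunctor A).map l ≫ (tildeCounit A).app F, ?_⟩⟩
  rw [← cancel_epi ((tildeCounit A).app F), ← Category.assoc, ← tildeCounit_naturality,
    Category.assoc, IsIso.hom_inv_id_assoc, ← Functor.map_comp_assoc, hl]
  simp

lemma isVectorBundle_trivialBundle (X : Scheme.{u}) (d : ℕ) :
    IsVectorBundle (trivialBundle X d) d := fun _ => ⟨⊤, trivial,
  ⟨(Scheme.Modules.restrictFunctorIsoPullback _).app _ ≪≫ pullbackTrivialBundleIso _ d⟩⟩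

lemma IsVectorBundle.of_iso {X : Scheme.{u}} {E F : X.Modules} {d : ℕ} (hE : IsVectorBundle E d)
    (e : E ≅ F) : IsVectorBundle F d := fun x => by
  obtain ⟨U, hxU, ⟨i⟩⟩ := hE x
  exact ⟨U, hxU, ⟨(Scheme.Modules.restrictFunctor U.ι).mapIso e.symm ≪≫ i⟩⟩

lemma isVectorBundle_tilde {N : ModuleCat.{u} A} {d : ℕ} (e : N ≃ₗ[A] (Fin d → A)) :
    IsVectorBundle ((tildeFunctor A).obj N) d :=
  (isVectorBundle_trivialBundle _ _).of_iso ((tildeFunctor A).mapIso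
    (e ≪≫ₗ (Finsupp.linearEquivFunOnFinite _ _ _ ≪≫ₗ
        LinearEquiv.funCongrLeft _ _ Equiv.ulift.symm).symm).toModuleIso ≪≫
      tildeFunctorFreeIso A d).symm

lemma isVectorBundle_of_Γ [F.IsQuasicoherent] {d : ℕ} (e : (ΓFunctor A).obj F ≃ₗ[A] (Fin d → A)) :
    IsVectorBundle F d :=
  (isVectorBundle_tilde e).of_iso (asIso ((tildeCounit A).app F))

/-- `tilde` is a left adjoint and so preserves cokernels; the counits replace `F` and `M` by the
modules associated with their sections. -/
lemma isVectorBundle_cokernel [F.IsQuasicoherent] [M.IsQuasicoherent] (j : F ⟶ M) {d : ℕ}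
    (e : (cokernel ((ΓFunctor A).map j) : ModuleCat.{u} A) ≃ₗ[A] (Fin d → A)) :
    IsVectorBundle (cokernel j) d :=
  (isVectorBundle_tilde e).of_iso (PreservesCokernel.iso (tildeFunctor A) ((ΓFunctor A).map j) ≪≫
        cokernel.mapIso _ _ (asIso ((tildeCounit A).app F)) (asIso ((tildeCounit A).app M))
          (tildeCounit_naturality j))

/-- The module associated with `N` works: `j` is the adjoint transpose of `i`, and the triangle
identity recovers `i` on sections. -/
lemma exists_hom_of_hom_Γ {N : ModuleCat.{u} A} (i : N ⟶ (ΓFunctor A).obj M) :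
    ∃ (F : (Spec A).Modules) (_ : F.IsQuasicoherent) (e : N ≅ (ΓFunctor A).obj F) (j : F ⟶ M),
      e.hom ≫ (ΓFunctor A).map j = i := by
  refine ⟨(tildeFunctor A).obj N, inferInstance, (tildeUnitIso A).app N,
    (tildeFunctor A).map i ≫ (tildeCounit A).app M, ?_⟩
  have h := (tildeUnitIso A).hom.naturality i
  simp only [Functor.id_map, Functor.comp_map] at h
  rw [Iso.app_hom, Functor.map_comp, ← reassoc_of% h, Γ_triangle]
  exact Category.comp_id i

end Affine

section SpecField

variable {K : Type u} [Field K] {F F' M : (Spec (.of K)).Modules}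

lemma isSplitMono_of_Γ_injective [F.IsQuasicoherent] [M.IsQuasicoherent] (j : F ⟶ M)
    (hj : Function.Injective ((ΓFunctor (.of K)).map j)) : IsSplitMono j := by
  obtain ⟨s, hs⟩ := LinearMap.exists_leftInverse_of_injective (K := K)
    ((ΓFunctor (.of K)).map j).hom (LinearMap.ker_eq_bot.2 hj)
  exact isSplitMono_of_Γ j (homOfLinear s) (ModuleCat.hom_ext hs)

lemma exists_lift_of_range_le [F.IsQuasicoherent] (j : F ⟶ M) (j' : F' ⟶ M)
    (hj' : Function.Injective ((ΓFunctor (.of K)).map j'))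
    (h : LinearMap.range ((ΓFunctor (.of K)).map j).hom ≤
      LinearMap.range ((ΓFunctor (.of K)).map j').hom) : ∃ a : F ⟶ F', a ≫ j' = j := by
  let ε := LinearEquiv.ofInjective ((ΓFunctor (.of K)).map j').hom hj'
  refine exists_lift_of_Γ j j' (homOfLinear
    (ε.symm.toLinearMap ∘ₗ ((ΓFunctor (.of K)).map j).hom.codRestrict _ fun x => h ⟨x, rfl⟩))
    (ModuleCat.hom_ext (LinearMap.ext fun x => ?_))
  exact congrArg Subtype.val (ε.apply_symm_apply ⟨(ΓFunctor (.of K)).map j x, h ⟨x, rfl⟩⟩)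

/-- Two quasi-coherent submodules on the spectrum of a field with the same global sections
agree. -/
lemma exists_iso_of_Γ_range_eq [F.IsQuasicoherent] [F'.IsQuasicoherent] [M.IsQuasicoherent]
    (j : F ⟶ M) (j' : F' ⟶ M) (hj : Function.Injective ((ΓFunctor (.of K)).map j))
    (hj' : Function.Injective ((ΓFunctor (.of K)).map j'))
    (h : LinearMap.range ((ΓFunctor (.of K)).map j).hom =
      LinearMap.range ((ΓFunctor (.of K)).map j').hom) :
    ∃ e : F ≅ F', e.hom ≫ j' = j := by
  obtain ⟨a, ha⟩ := exists_lift_of_range_le j j' hj' h.le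
  obtain ⟨b, hb⟩ := exists_lift_of_range_le j' j hj h.ge
  have := isSplitMono_of_Γ_injective j hj
  have := isSplitMono_of_Γ_injective j' hj'
  refine ⟨⟨a, b, ?_, ?_⟩, ha⟩
  · rw [← cancel_mono j, Category.assoc, hb, ha, Category.id_comp]
  · rw [← cancel_mono j', Category.assoc, ha, hb, Category.id_comp]

/-- On the spectrum of a field, subbundles are the monomorphisms on global sections. -/
theorem isSubbundle_of_Γ_injective [F.IsQuasicoherent] [M.IsQuasicoherent]
    [Module.Finite K ((ΓFunctor (.of K)).obj F)] [Module.Finite K ((ΓFunctor (.of K)).obj M)]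
    (j : F ⟶ M) (hj : Function.Injective ((ΓFunctor (.of K)).map j)) :
    IsSubbundle j (Module.finrank K ((ΓFunctor (.of K)).obj F)) where
  isVectorBundle := isVectorBundle_of_Γ (Module.finBasis K ((ΓFunctor (.of K)).obj F)).equivFun
  mono := have := isSplitMono_of_Γ_injective j hj; inferInstance
  quotient := by
    have : Module.Finite K (cokernel ((ΓFunctor (.of K)).map j) : ModuleCat K) :=
      Module.Finite.of_surjective (cokernel.π ((ΓFunctor (.of K)).map j)).hom
        ((ModuleCat.epi_iff_surjective _).1 inferInstance)
    exact (isVectorBundle_cokernel j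
      (Module.finBasis K (cokernel ((ΓFunctor (.of K)).map j) :
        ModuleCat K)).equivFun).isFiniteLocallyFree

/-- Every subspace of the global sections of a finite-dimensional module on the spectrum of a field
comes from a subbundle. -/
theorem exists_isSubbundle_range_eq [M.IsQuasicoherent]
    [Module.Finite K ((ΓFunctor (.of K)).obj M)]
    (W : Submodule K ((ΓFunctor (.of K)).obj M)) :
    ∃ (F : (Spec (.of K)).Modules) (j : F ⟶ M), IsSubbundle j (Module.finrank K W) ∧
      LinearMap.range ((ΓFunctor (.of K)).map j).hom = W := by
  obtain ⟨F, hF, e, j, h⟩ := exists_hom_of_hom_Γ (A := .of K) (M := M)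
    (homOfLinear (M := ModuleCat.of K W) W.subtype)
  let e' : W ≃ₗ[K] (ΓFunctor (.of K)).obj F := e.toLinearEquiv
  have h' : ∀ w : W, (ΓFunctor (.of K)).map j (e' w) = w := fun w =>
    ConcreteCategory.congr_hom h w
  have : Module.Finite K ((ΓFunctor (.of K)).obj F) := Module.Finite.equiv e'
  have hr : Module.finrank K ((ΓFunctor (.of K)).obj F) = Module.finrank K W :=
    e'.finrank_eq.symm
  have hinj : Function.Injective ((ΓFunctor (.of K)).map j) := fun v v' hv => by
    obtain ⟨w, rfl⟩ := e'.surjective v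
    obtain ⟨w', rfl⟩ := e'.surjective v'
    rw [h', h'] at hv
    rw [Subtype.ext hv]
  refine ⟨F, j, hr ▸ isSubbundle_of_Γ_injective j hinj, le_antisymm ?_ fun v hv => ⟨_, h' ⟨v, hv⟩⟩⟩
  rintro _ ⟨x, rfl⟩
  obtain ⟨w, rfl⟩ := e'.surjective x
  exact (h' w).symm ▸ w.2

end SpecField

end

/-! ### Coherence of pulled back inclusions and subspaces of fibers. -/

noncomputable section

section Coherence

variable {S G T Y : Scheme.{u}}

lemma pullbackCongr_rfl (f : T ⟶ S) :
    Scheme.Modules.pullbackCongr (rfl : f = f) = Iso.refl _ := rfl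

lemma pullbackCongr_comp_symm {f g : T ⟶ S} (h : f = g) (E : S.Modules) :
    (Scheme.Modules.pullbackCongr h).hom.app E ≫
      (Scheme.Modules.pullbackCongr h.symm).hom.app E = 𝟙 _ := by
  subst h
  simp [pullbackCongr_rfl]

/-- This is associativity of the pullback pseudofunctor at `E`, with the inverse comparisons moved
to the other side. -/
lemma pullbackComp_assoc_app (h : Y ⟶ T) (a : T ⟶ G) (π : G ⟶ S) (E : S.Modules) :
    (Scheme.Modules.pullbackComp h a).hom.app ((Scheme.Modules.pullback π).obj E) ≫
      (Scheme.Modules.pullbackComp (h ≫ a) π).hom.app E =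
    (Scheme.Modules.pullback h).map ((Scheme.Modules.pullbackComp a π).hom.app E) ≫
      (Scheme.Modules.pullbackComp h (a ≫ π)).hom.app E ≫
      (Scheme.Modules.pullbackCongr (Category.assoc h a π).symm).hom.app E := by
  have key := congr_app (Scheme.Modules.pseudofunctor_associativity h a π) E
  simp only [NatTrans.comp_app, Functor.whiskerRight_app, Functor.whiskerLeft_app,
    Functor.associator_hom_app, Category.id_comp] at key
  replace key := (Iso.inv_comp_eq ((Scheme.Modules.pullbackComp h (a ≫ π)).app E)).1 key
  have h2 : (Scheme.Modules.pullback h).map ((Scheme.Modules.pullbackComp a π).hom.app E) ≫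
      (Scheme.Modules.pullback h).map ((Scheme.Modules.pullbackComp a π).inv.app E) = 𝟙 _ := by
    rw [← Functor.map_comp, Iso.hom_inv_id_app, CategoryTheory.Functor.map_id]
  have key2 := congrArg (fun t => (Scheme.Modules.pullback h).map
    ((Scheme.Modules.pullbackComp a π).hom.app E) ≫ t) key
  simp only [reassoc_of% h2] at key2
  exact key2

/-- Pullback of inclusions of subbundles is compatible with composition. -/
lemma pullback_map_pullbackInclusion {E : S.Modules} {π : G ⟶ S} {F : G.Modules}
    (ι : F ⟶ (Scheme.Modules.pullback π).obj E) (a : T ⟶ G) (p : T ⟶ S) (ha : a ≫ π = p)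
    (h : Y ⟶ T) (k : Y ⟶ G) (hk : h ≫ a = k) (q : Y ⟶ S) (hq : h ≫ p = q) :
    (Scheme.Modules.pullback h).map (pullbackInclusion ι a p ha) ≫
      (Scheme.Modules.pullbackComp h p).hom.app E ≫
        (Scheme.Modules.pullbackCongr hq).hom.app E =
    ((Scheme.Modules.pullbackComp h a).hom.app F ≫
      (Scheme.Modules.pullbackCongr hk).hom.app F) ≫
        pullbackInclusion ι k q (by rw [← hk, ← hq, ← ha, Category.assoc]) := by
  subst ha hk hq
  have h1 := (Scheme.Modules.pullbackComp h a).hom.naturality ι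
  have h2 := pullbackComp_assoc_app h a π E
  simp only [Functor.comp_map] at h1
  simp only [pullbackInclusion, pullbackCongr_rfl, Iso.refl_hom,
    NatTrans.id_app, Category.comp_id, Functor.map_comp, Category.assoc]
  rw [← reassoc_of% h1, reassoc_of% h2, pullbackCongr_comp_symm, Category.comp_id]

end Coherence

section Fiber

variable {S G T : Scheme.{u}} {K : Type u} [Field K]

/-- The fiber of a pullback is the fiber at the image point. -/
def fiberPullbackIso (h : Spec (.of K) ⟶ T) (p : T ⟶ S) (q : Spec (.of K) ⟶ S) (hq : h ≫ p = q) :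
    Scheme.Modules.pullback p ⋙ fiberFunctor h ≅ fiberFunctor q :=
  Functor.isoWhiskerRight
    (Scheme.Modules.pullbackComp h p ≪≫ Scheme.Modules.pullbackCongr hq) (ΓFunctor (.of K))

/-- The subspace of the fiber of `E` defined by a submodule of a pullback of `E`, at a field-valued
point. -/
def fiberSubspace {E : S.Modules} {π : G ⟶ S} {F : G.Modules}
    (ι : F ⟶ (Scheme.Modules.pullback π).obj E) (k : Spec (.of K) ⟶ G) (q : Spec (.of K) ⟶ S)
    (hk : k ≫ π = q) : Submodule K ((fiberFunctor q).obj E) :=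
  LinearMap.range ((ΓFunctor (.of K)).map (pullbackInclusion ι k q hk)).hom

/-- The comparison isomorphism on fibers, as a linear equivalence. -/
def fiberPullbackEquiv (h : Spec (.of K) ⟶ T) (p : T ⟶ S) (q : Spec (.of K) ⟶ S)
    (hq : h ≫ p = q) (E : S.Modules) :
    (fiberFunctor h).obj ((Scheme.Modules.pullback p).obj E) ≃ₗ[K] (fiberFunctor q).obj E :=
  ((fiberPullbackIso h p q hq).app E).toLinearEquiv

lemma fiberPullbackEquiv_naturality (h : Spec (.of K) ⟶ T) (p : T ⟶ S) (q : Spec (.of K) ⟶ S)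
    (hq : h ≫ p = q) {E E' : S.Modules} (φ : E ⟶ E')
    (v : (fiberFunctor h).obj ((Scheme.Modules.pullback p).obj E)) :
    fiberPullbackEquiv h p q hq E' ((fiberFunctor h).map ((Scheme.Modules.pullback p).map φ) v) =
      (fiberFunctor q).map φ (fiberPullbackEquiv h p q hq E v) :=
  ConcreteCategory.congr_hom ((fiberPullbackIso h p q hq).hom.naturality φ) v

/-- Coherence identifies the two inclusions up to an isomorphism of their sources, so the ranges
agree. Conditions on `T` can thus be tested on subspaces of the one fiber of `E` at `q`. -/
lemma map_range_pullbackInclusion {E : S.Modules} {π : G ⟶ S} {F : G.Modules}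
    (ι : F ⟶ (Scheme.Modules.pullback π).obj E) (a : T ⟶ G) (p : T ⟶ S) (ha : a ≫ π = p)
    (h : Spec (.of K) ⟶ T) (k : Spec (.of K) ⟶ G) (hk : h ≫ a = k) (q : Spec (.of K) ⟶ S)
    (hq : h ≫ p = q) (hkq : k ≫ π = q) (v) :
    fiberPullbackEquiv h p q hq E v ∈ fiberSubspace ι k q hkq ↔
      v ∈ LinearMap.range ((fiberFunctor h).map (pullbackInclusion ι a p ha)).hom := by
  have key := congrArg (ΓFunctor (.of K)).map
    (pullback_map_pullbackInclusion ι a p ha h k hk q hq)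
  let ε : (fiberFunctor h).obj ((Scheme.Modules.pullback a).obj F) ≃ₗ[K] (fiberFunctor k).obj F :=
    fiberPullbackEquiv h a k hk F
  have key' : ∀ w, fiberPullbackEquiv h p q hq E
      ((fiberFunctor h).map (pullbackInclusion ι a p ha) w) =
      (ΓFunctor (.of K)).map (pullbackInclusion ι k q hkq) (ε w) := fun w => by
    simp only [Functor.map_comp] at key
    exact ConcreteCategory.congr_hom key w
  constructor
  · rintro ⟨w, hw⟩
    obtain ⟨w, rfl⟩ := ε.surjective w
    exact ⟨w, (fiberPullbackEquiv h p q hq E).injective ((key' w).trans hw)⟩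
  · rintro ⟨w, rfl⟩
    exact ⟨ε w, (key' w).symm⟩

end Fiber

end

/-! ### Fibers of subbundles and field-valued points of Grassmannians. -/

noncomputable section

section Split

variable {K : Type u} [Field K]

lemma splitting_injective {S : ShortComplex (ModuleCat.{u} K)} (s : S.Splitting) :
    Function.Injective S.f := fun x y h => by
  have key := fun x => ConcreteCategory.congr_hom s.f_r x
  exact (key x).symm.trans ((congrArg s.r h).trans (key y))

lemma splitting_mem_range_iff {S : ShortComplex (ModuleCat.{u} K)} (s : S.Splitting) (v : S.X₂) :
    v ∈ LinearMap.range S.f.hom ↔ S.g v = 0 := by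
  constructor
  · rintro ⟨w, rfl⟩
    exact ConcreteCategory.congr_hom S.zero w
  · intro h
    refine ⟨s.r v, ?_⟩
    have key : S.f (s.r v) + s.s (S.g v) = v := ConcreteCategory.congr_hom s.id v
    rw [h, map_zero, add_zero] at key
    exact key

end Split

section Pullback

variable {S G T : Scheme.{u}} {E : S.Modules} {π : G ⟶ S} {F : G.Modules}
  {ι : F ⟶ (Scheme.Modules.pullback π).obj E} {r : ℕ}

/-- The quotient by the pullback of a submodule is the pullback of the quotient. -/
def cokernelComplexPullbackIso (ι : F ⟶ (Scheme.Modules.pullback π).obj E) (a : T ⟶ G) (p : T ⟶ S)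
    (ha : a ≫ π = p) :
    (cokernelComplex ι).map (Scheme.Modules.pullback a) ≅
      cokernelComplex (pullbackInclusion ι a p ha) :=
  let e : (Scheme.Modules.pullback a).obj ((Scheme.Modules.pullback π).obj E) ≅
      (Scheme.Modules.pullback p).obj E :=
    (Scheme.Modules.pullbackComp a π ≪≫ Scheme.Modules.pullbackCongr ha).app E
  have h : (Scheme.Modules.pullback a).map ι ≫ e.hom =
      (Iso.refl _).hom ≫ pullbackInclusion ι a p ha := by
    simp [e, pullbackInclusion]
  ShortComplex.isoMk (Iso.refl _) e
    (PreservesCokernel.iso (Scheme.Modules.pullback a) ι ≪≫ cokernel.mapIso _ _ (Iso.refl _) e h)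
    h.symm (by
      have h1 := PreservesCokernel.π_iso_hom (Scheme.Modules.pullback a) ι
      have h2 : cokernel.π ((Scheme.Modules.pullback a).map ι) ≫
          cokernel.map _ _ (𝟙 _) e.hom h = e.hom ≫ cokernel.π (pullbackInclusion ι a p ha) :=
        cokernel.π_desc _ _ _
      exact h2.symm.trans ((congrArg (· ≫ cokernel.map _ _ (𝟙 _) e.hom h) h1.symm).trans
        (Category.assoc _ _ _)))

lemma IsSubbundle.cokernel_pullbackInclusion (h : IsSubbundle ι r) (a : T ⟶ G) (p : T ⟶ S)
    (ha : a ≫ π = p) : IsFiniteLocallyFree (cokernel (pullbackInclusion ι a p ha)) :=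
  (h.quotient.pullback a).of_iso
    (ShortComplex.π₃.mapIso (cokernelComplexPullbackIso ι a p ha))

variable {K : Type u} [Field K]

lemma IsSubbundle.nonempty_splitting_pullbackInclusion (h : IsSubbundle ι r)
    (hE : IsFiniteLocallyFree E) (a : T ⟶ G) (p : T ⟶ S) (ha : a ≫ π = p)
    (x : Spec (.of K) ⟶ T) :
    Nonempty ((cokernelComplex (pullbackInclusion ι a p ha)).map (fiberFunctor x)).Splitting := by
  obtain ⟨s⟩ := h.nonempty_splitting_fiber (hE.pullback π) (x ≫ a)
  let i := fiberPullbackIso x a (x ≫ a) rfl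
  let i' : (cokernelComplex ι).map (fiberFunctor (x ≫ a)) ≅
      ((cokernelComplex ι).map (Scheme.Modules.pullback a)).map (fiberFunctor x) :=
    ShortComplex.isoMk (i.app F).symm (i.app _).symm (i.app (cokernel ι)).symm
      (i.inv.naturality ι).symm (i.inv.naturality (cokernel.π ι)).symm
  exact ⟨s.ofIso (i' ≪≫ (fiberFunctor x).mapShortComplex.mapIso (cokernelComplexPullbackIso ι a p ha))⟩

/-- Membership in the fiber of a submodule is detected by the quotient. -/
lemma IsSubbundle.mem_fiberSubspace_iff (h : IsSubbundle ι r)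
    (hE : IsFiniteLocallyFree E) (a : T ⟶ G) (p : T ⟶ S) (ha : a ≫ π = p)
    (x : Spec (.of K) ⟶ T) (k : Spec (.of K) ⟶ G) (hk : x ≫ a = k) (q : Spec (.of K) ⟶ S)
    (hq : x ≫ p = q) (hkq : k ≫ π = q) (v) :
    fiberPullbackEquiv x p q hq E v ∈ fiberSubspace ι k q hkq ↔
      (fiberFunctor x).map (cokernel.π (pullbackInclusion ι a p ha)) v = 0 := by
  obtain ⟨s⟩ := h.nonempty_splitting_pullbackInclusion hE a p ha x
  rw [map_range_pullbackInclusion ι a p ha x k hk q hq hkq]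
  exact splitting_mem_range_iff s v

/-- Up to the comparison isomorphism this is the fiber of `ι` at `k`, a split injection. -/
lemma IsSubbundle.Γ_pullbackInclusion_injective (h : IsSubbundle ι r)
    (hE : IsFiniteLocallyFree E) (k : Spec (.of K) ⟶ G) (q : Spec (.of K) ⟶ S)
    (hk : k ≫ π = q) :
    Function.Injective ((ΓFunctor (.of K)).map (pullbackInclusion ι k q hk)) := by
  obtain ⟨s⟩ := h.nonempty_splitting_fiber (hE.pullback π) k
  have h1 : Function.Injective ((fiberFunctor k).map ι) := splitting_injective s
  intro v w hvw
  apply h1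
  apply (fiberPullbackEquiv k π q hk E).injective
  simp only [pullbackInclusion, Functor.map_comp] at hvw
  exact hvw

lemma IsSubbundle.finrank_fiberSubspace (h : IsSubbundle ι r)
    (hE : IsFiniteLocallyFree E) (k : Spec (.of K) ⟶ G) (q : Spec (.of K) ⟶ S)
    (hk : k ≫ π = q) : Module.finrank K (fiberSubspace ι k q hk) = r := by
  rw [fiberSubspace]
  refine (LinearEquiv.finrank_eq (LinearEquiv.ofInjective
    ((ΓFunctor (.of K)).map (pullbackInclusion ι k q hk)).hom
    (h.Γ_pullbackInclusion_injective hE k q hk))).symm.trans ?_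
  exact h.isVectorBundle.finrank_fiber k

end Pullback

section Grassmannian

variable {S G : Scheme.{u}} {E : S.Modules} {π : G ⟶ S} {F : G.Modules}
  {ι : F ⟶ (Scheme.Modules.pullback π).obj E} {r : ℕ} {K : Type u} [Field K]

/-- A field-valued point of the Grassmannian is determined by the corresponding subspace. -/
theorem IsGrassmannian.eq_of_fiberSubspace_eq (hG : IsGrassmannian r E π ι)
    (hE : IsFiniteLocallyFree E) (k k' : Spec (.of K) ⟶ G) (q : Spec (.of K) ⟶ S)
    (hk : k ≫ π = q) (hk' : k' ≫ π = q)
    (h : fiberSubspace ι k q hk = fiberSubspace ι k' q hk') : k = k' := by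
  have hF := hG.isSubbundle.isVectorBundle.isFiniteLocallyFree
  have := (hF.pullback k).isQuasicoherent
  have := (hF.pullback k').isQuasicoherent
  have := (hE.pullback q).isQuasicoherent
  have f₁ : Module.Finite K ((ΓFunctor (.of K)).obj ((Scheme.Modules.pullback k).obj F)) :=
    hF.finite_fiber k
  have f₂ : Module.Finite K ((ΓFunctor (.of K)).obj ((Scheme.Modules.pullback q).obj E)) :=
    hE.finite_fiber q
  have hj := hG.isSubbundle.Γ_pullbackInclusion_injective hE k q hk
  have hj' := hG.isSubbundle.Γ_pullbackInclusion_injective hE k' q hk'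
  have hr : Module.finrank K ((ΓFunctor (.of K)).obj ((Scheme.Modules.pullback k).obj F)) = r :=
    hG.isSubbundle.isVectorBundle.finrank_fiber k
  have hs : IsSubbundle (pullbackInclusion ι k q hk) r := by
    have := isSubbundle_of_Γ_injective (pullbackInclusion ι k q hk) hj
    rwa [hr] at this
  -- Both points classify the pullback of the universal subbundle along `k`: the first
  -- tautologically, the second because submodules over a field are determined by their sections.
  refine (hG.existsUnique _ q _ _ hs).unique ⟨hk, Iso.refl _, Category.id_comp _⟩ ⟨hk', ?_⟩
  exact exists_iso_of_Γ_range_eq _ _ hj' hj h.symm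

/-- Every subspace of the fiber comes from a field-valued point of the Grassmannian. -/
theorem IsGrassmannian.exists_fiberSubspace_eq (hG : IsGrassmannian r E π ι)
    (hE : IsFiniteLocallyFree E) (q : Spec (.of K) ⟶ S)
    (W : Submodule K ((fiberFunctor q).obj E)) (hW : Module.finrank K W = r) :
    ∃ (k : Spec (.of K) ⟶ G) (hk : k ≫ π = q), fiberSubspace ι k q hk = W := by
  have := (hE.pullback q).isQuasicoherent
  have f₂ : Module.Finite K ((ΓFunctor (.of K)).obj ((Scheme.Modules.pullback q).obj E)) :=
    hE.finite_fiber q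
  obtain ⟨F', j, hj, hr⟩ := exists_isSubbundle_range_eq
    (M := (Scheme.Modules.pullback q).obj E) W
  obtain ⟨k, ⟨hk, e, he⟩, -⟩ := hG.existsUnique _ q F' j (hW ▸ hj)
  refine ⟨k, hk, ?_⟩
  rw [← hr, fiberSubspace, ← he, Functor.map_comp, ModuleCat.hom_comp]
  exact LinearMap.range_comp_of_range_eq_top _
    ((ΓFunctor (.of K)).mapIso e).toLinearEquiv.range

end Grassmannian

end

/-! ### Direct sums, scalars, and independence of the field. -/

noncomputable section

section Biprod

/-- The direct sum of trivial bundles is trivial. -/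
lemma nonempty_trivialBundle_biprod_iso (X : Scheme.{u}) (d e : ℕ) :
    Nonempty ((trivialBundle X d ⊞ trivialBundle X e : X.Modules) ≅ trivialBundle X (d + e)) := by
  let F : Type u ⥤ X.Modules := SheafOfModules.freeFunctor (R := X.ringCatSheaf)
  have : PreservesColimitsOfShape (Discrete WalkingPair) F :=
    have : (sigmaConst.obj (SheafOfModules.unit X.ringCatSheaf)).IsLeftAdjoint :=
      (sigmaConstAdj _).isLeftAdjoint
    inferInstanceAs (PreservesColimitsOfShape (Discrete WalkingPair)
      (sigmaConst.obj (SheafOfModules.unit X.ringCatSheaf)))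
  exact ⟨biprod.isoCoprod (F.obj (ULift.{u} (Fin d))) (F.obj (ULift.{u} (Fin e))) ≪≫
    PreservesColimitPair.iso F _ _ ≪≫ F.mapIso (Types.binaryCoproductIso _ _ ≪≫
      (((Equiv.ulift.sumCongr Equiv.ulift).trans finSumFinEquiv).trans Equiv.ulift.symm).toIso)⟩

lemma IsFiniteLocallyFree.biprod {X : Scheme.{u}} {E H : X.Modules} (hE : IsFiniteLocallyFree E)
    (hH : IsFiniteLocallyFree H) : IsFiniteLocallyFree (E ⊞ H) := fun x => by
  obtain ⟨U, d, hxU, hU⟩ := hE x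
  obtain ⟨V, e, hxV, hV⟩ := hH x
  obtain ⟨i⟩ := nonempty_pullback_iso_trivialBundle hU (U ⊓ V).ι (by simp)
  obtain ⟨j⟩ := nonempty_pullback_iso_trivialBundle hV (U ⊓ V).ι (by simp)
  obtain ⟨k⟩ := nonempty_trivialBundle_biprod_iso ((U ⊓ V : X.Opens) : Scheme.{u}) d e
  have : PreservesBinaryBiproducts (Scheme.Modules.pullback (U ⊓ V).ι) :=
    preservesBinaryBiproducts_of_preservesBiproducts _
  exact ⟨U ⊓ V, d + e, ⟨hxU, hxV⟩,
    ⟨(Scheme.Modules.restrictFunctorIsoPullback _).app _ ≪≫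
      (Scheme.Modules.pullback (U ⊓ V).ι).mapBiprod E H ≪≫ biprod.mapIso i j ≪≫ k⟩⟩

end Biprod

section Scalar

variable {X : Scheme.{u}} {K : Type u} [Field K]

open TensorProduct in
lemma baseChange_apply_of_smul {A k M : Type*} [CommRing A] [CommRing k] [Algebra A k]
    [AddCommGroup M] [Module A M] (f : M →ₗ[A] M) (a : A) (hf : ∀ m, f m = a • m) (v : k ⊗[A] M) :
    f.baseChange k v = algebraMap A k a • v := by
  induction v with
  | zero => simp
  | add v w hv hw => rw [map_add, hv, hw, smul_add]
  | tmul c m => rw [LinearMap.baseChange_tmul, hf, algebraMap_smul, tmul_smul]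

lemma extendScalars_map_apply_of_smul {A : CommRingCat.{u}} (ψ : A ⟶ .of K) {M : ModuleCat.{u} A}
    (f : M ⟶ M) (a : A) (hf : ∀ m, f m = a • m) (v) :
    (ModuleCat.extendScalars ψ.hom).map f v = (ψ a) • v := by
  let := ψ.hom.toAlgebra
  exact baseChange_apply_of_smul (k := K) f.hom a hf v

/-- Multiplication by a global function on a module acts on the fiber at a field-valued point by
the value of the function. -/
theorem exists_fiberFunctor_map_eq_smul (q : Spec (.of K) ⟶ X) (y) (s : Γ(X, ⊤)) :
    ∃ c : K, (c = 0 ↔ X.Γevaluation (q y) s = 0) ∧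
      ∀ {E H : X.Modules} (φ : E ⟶ H) (φ' : H ⟶ E), IsFiniteLocallyFree E → CompEqSMul φ φ' s →
        ∀ v, (fiberFunctor q).map φ' ((fiberFunctor q).map φ v) = c • v := by
  obtain ⟨U, hU, hxU, -⟩ := exists_isAffineOpen_mem_and_subset
    (x := q y) (U := ⊤) trivial
  obtain ⟨ψ, hψ⟩ := exists_specMap_fromSpec q hU (range_subset_of_mem q hxU)
  -- The scalar is the value of `s` at the `K`-valued point. It vanishes exactly when the image
  -- point lies outside the basic open set of `s`.
  refine ⟨ψ (X.presheaf.map (homOfLE (le_top : U ≤ ⊤)).op s), ?_, ?_⟩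
  · have h1 := mem_basicOpen_iff q hU ψ hψ y (X.presheaf.map (homOfLE (le_top : U ≤ ⊤)).op s)
    rw [Scheme.basicOpen_res] at h1
    refine Iff.trans ?_ (X.evaluation_eq_zero_iff_notMem_basicOpen (U := ⊤) (q y) trivial s).symm
    rw [← not_iff_not, ← ne_eq, ← h1, not_not]
    exact ⟨fun h => h.2, fun h => ⟨hxU, h⟩⟩
  · intro E H φ φ' hE h v
    have := hE.isQuasicoherent
    have i₁ := isIso_fiberComparison_app ψ hU.fromSpec hψ E
    let e := (@asIso _ _ _ _ _ i₁).toLinearEquiv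
    have hf : ∀ m, (affineSections hU.fromSpec).map (φ ≫ φ') m =
        X.presheaf.map (homOfLE (le_top : U ≤ ⊤)).op s • m := by
      intro m
      obtain ⟨m, rfl⟩ := (affineSectionsEquiv hU E).surjective m
      rw [← affineSectionsEquiv_naturality, ← LinearEquiv.map_smul]
      exact congrArg _ (h U m)
    obtain ⟨v, rfl⟩ := e.surjective v
    have h1 := ConcreteCategory.congr_hom
      ((fiberComparison ψ hU.fromSpec hψ).naturality (φ ≫ φ')) v
    have h2 := extendScalars_map_apply_of_smul ψ _ _ hf v
    have h3 : (fiberFunctor q).map φ' ((fiberFunctor q).map φ (e v)) =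
        e ((ModuleCat.extendScalars ψ.hom).map ((affineSections hU.fromSpec).map (φ ≫ φ')) v) := by
      refine Eq.trans ?_ h1.symm
      rw [Functor.map_comp]
      rfl
    rw [h3, h2]
    exact e.map_smul _ _

end Scalar

section Ranks

/-- Both sides say that `g` is injective on the range of `f`. The condition `im f ∩ ker g = 0`
becomes an inequality of ranks, a form that transfers between fields. -/
lemma finrank_range_le_comp_iff {K U V W : Type*} [Field K] [AddCommGroup U] [Module K U]
    [AddCommGroup V] [Module K V] [AddCommGroup W] [Module K W] [FiniteDimensional K V]
    (f : U →ₗ[K] V) (g : V →ₗ[K] W) :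
    Module.finrank K (LinearMap.range f) ≤ Module.finrank K (LinearMap.range (g ∘ₗ f)) ↔
      ∀ v, g (f v) = 0 → f v = 0 := by
  have h1 : LinearMap.range (g ∘ₗ f) = LinearMap.range (g.domRestrict (LinearMap.range f)) := by
    rw [LinearMap.range_comp, LinearMap.range_domRestrict]
  have h2 := LinearMap.finrank_range_add_finrank_ker (g.domRestrict (LinearMap.range f))
  rw [h1]
  have h3 : Module.finrank K (LinearMap.range f) ≤
      Module.finrank K (LinearMap.range (g.domRestrict (LinearMap.range f))) ↔
      Module.finrank K (LinearMap.ker (g.domRestrict (LinearMap.range f))) = 0 := by omega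
  rw [h3, Submodule.finrank_eq_zero, LinearMap.ker_eq_bot']
  constructor
  · intro h v hv
    exact congrArg Subtype.val (h ⟨f v, v, rfl⟩ hv)
  · rintro h ⟨_, v, rfl⟩ hv
    exact Subtype.ext (h v hv)

variable {X : Scheme.{u}} {K : Type u} [Field K]

/-- A condition on the fibers at a point holds for all field-valued points over it. -/
theorem fiberFunctor_map_eq_zero_of_range_inf_ker {E F H : X.Modules}
    (hE : IsFiniteLocallyFree E) (hF : IsFiniteLocallyFree F) (hH : IsFiniteLocallyFree H)
    (φ : E ⟶ F) (φ' : F ⟶ H) (q : Spec (.of K) ⟶ X) (y)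
    (h : (fiberMap φ (q y)).range ⊓ (fiberMap φ' (q y)).ker = ⊥) (v)
    (hv : (fiberFunctor q).map φ' ((fiberFunctor q).map φ v) = 0) :
    (fiberFunctor q).map φ v = 0 := by
  have := hF.finite_fiber q
  let x : Spec (.of (X.residueField (q y))) ⟶ X := X.fromSpecResidueField (q y)
  have := hF.finite_fiber x
  have hx : ∀ z, x z = q y := Scheme.fromSpecResidueField_apply _
  have hcomp : ∀ {L : Type u} [Field L] (g : Spec (.of L) ⟶ X),
      ((fiberFunctor g).map (φ ≫ φ')).hom =
        ((fiberFunctor g).map φ').hom ∘ₗ ((fiberFunctor g).map φ).hom := fun g => by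
    rw [Functor.map_comp, ModuleCat.hom_comp]
  have hκ : ∀ w, (fiberFunctor x).map φ' ((fiberFunctor x).map φ w) = 0 →
      (fiberFunctor x).map φ w = 0 := by
    intro w hw
    have hmem : (fiberFunctor x).map φ w ∈
        (fiberMap φ (q y)).range ⊓ (fiberMap φ' (q y)).ker := ⟨⟨w, rfl⟩, hw⟩
    rw [h] at hmem
    exact hmem
  rw [← finrank_range_le_comp_iff (K := X.residueField (q y)) ((fiberFunctor x).map φ).hom
    ((fiberFunctor x).map φ').hom, ← hcomp] at hκ
  refine (finrank_range_le_comp_iff (K := K) ((fiberFunctor q).map φ).hom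
    ((fiberFunctor q).map φ').hom).1 ?_ v hv
  rw [← hcomp]
  -- The ranks of `φ` and of `φ ≫ φ'` are the same over `K` and over the residue field, since the
  -- rank loci see only the underlying point. The inequality over the residue field therefore passes
  -- to `K`.
  refine le_trans ?_ (hκ.trans ?_)
  · have key : ∀ n, Module.finrank _ (LinearMap.range ((fiberFunctor x).map φ).hom) ≤ n →
        Module.finrank K (LinearMap.range ((fiberFunctor q).map φ).hom) ≤ n := fun n hn => by
      rw [← mem_support_rankLEIdeal_iff q hE hF φ _ y, ← hx default]
      exact (mem_support_rankLEIdeal_iff x hE hF φ _ _).2 hn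
    exact key _ le_rfl
  · rw [← mem_support_rankLEIdeal_iff x hE hH (φ ≫ φ') _ default, hx,
      mem_support_rankLEIdeal_iff q hE hH (φ ≫ φ')]

end Ranks

end

/-! ### The subspaces of a chain cut out by subspaces at its ends. -/

noncomputable section

section EndsSubspace

open Module

variable {k : Type*} [Field k] {m : ℕ} {V : Fin (m + 1) → Type*} [∀ i, AddCommGroup (V i)]
  [∀ i, Module k (V i)] {up : ∀ i : Fin m, V i.castSucc →ₗ[k] V i.succ}
  {down : ∀ i : Fin m, V i.succ →ₗ[k] V i.castSucc}
  (toFirst : ∀ i, V i →ₗ[k] V 0) (toLast : ∀ i, V i →ₗ[k] V (Fin.last m))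

/-- The vectors whose images in the first and last members of a chain lie in given subspaces. -/
def endsSubspace (W₀ : Submodule k (V 0)) (W₁ : Submodule k (V (Fin.last m))) (i : Fin (m + 1)) :
    Submodule k (V i) :=
  W₀.comap (toFirst i) ⊓ W₁.comap (toLast i)

variable {toFirst toLast}
variable (hf0 : ∀ v, toFirst 0 v = v)
  (hf : ∀ i v, toFirst (Fin.succ i) v = toFirst (Fin.castSucc i) (down i v))
  (hl0 : ∀ v, toLast (Fin.last m) v = v)
  (hl : ∀ i v, toLast (Fin.castSucc i) v = toLast (Fin.succ i) (up i v))

include hf0 hf hl0 hl in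
lemma IsLinkedFamily.le_endsSubspace {W : ∀ i, Submodule k (V i)}
    (hW : IsLinkedFamily up down W) (i) :
    W i ≤ endsSubspace toFirst toLast (W 0) (W (Fin.last m)) i := by
  refine le_inf ?_ ?_
  · induction i using Fin.induction with
    | zero => exact fun v hv => by rwa [Submodule.mem_comap, hf0]
    | succ i ih =>
      exact fun v hv => by rw [Submodule.mem_comap, hf]; exact ih (hW.2 i ⟨v, hv, rfl⟩)
  · induction i using Fin.reverseInduction with
    | last => exact fun v hv => by rwa [Submodule.mem_comap, hl0]
    | cast i ih =>
      exact fun v hv => by rw [Submodule.mem_comap, hl]; exact ih (hW.1 i ⟨v, hv, rfl⟩)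

variable {c : k} (hud : ∀ i v, up i (down i v) = c • v) (hdu : ∀ i v, down i (up i v) = c • v)

include hf hl hud hdu in
-- Moving one step towards an end is part of the composite to that end. Moving one step away
-- multiplies the composite by `c`, and subspaces absorb scalars.
lemma isLinkedFamily_endsSubspace (W₀ : Submodule k (V 0))
    (W₁ : Submodule k (V (Fin.last m))) :
    IsLinkedFamily up down (endsSubspace toFirst toLast W₀ W₁) := by
  refine ⟨fun i => ?_, fun i => ?_⟩
  · rintro _ ⟨v, ⟨h1, h2⟩, rfl⟩
    refine ⟨?_, ?_⟩
    · change toFirst _ _ ∈ W₀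
      rw [hf, hdu, map_smul]
      exact W₀.smul_mem c h1
    · change toLast _ _ ∈ W₁
      rw [← hl]
      exact h2
  · rintro _ ⟨v, ⟨h1, h2⟩, rfl⟩
    refine ⟨?_, ?_⟩
    · change toFirst _ _ ∈ W₀
      rw [← hf]
      exact h1
    · change toLast _ _ ∈ W₁
      rw [hl, hud, map_smul]
      exact W₁.smul_mem c h2

include hf0 hf hl0 hl hud hdu in
/-- Subspaces of dimension `r` of the ends of a chain for which the associated subspaces of the
members of the chain have dimension at least `r` extend to a linked family of subspaces of
dimension `r`. -/
theorem exists_isLinkedFamily [∀ i, FiniteDimensional k (V i)]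
    (hdd : c = 0 → ∀ (a : Fin m) (ha : a.1 + 1 < m) (x : V (Fin.succ ⟨a.1 + 1, ha⟩)),
      down a (down ⟨a.1 + 1, ha⟩ x) = 0 → down ⟨a.1 + 1, ha⟩ x = 0)
    {r : ℕ} {W₀ : Submodule k (V 0)} {W₁ : Submodule k (V (Fin.last m))}
    (h0 : finrank k W₀ = r) (h1 : finrank k W₁ = r)
    (hr : ∀ i, r ≤ finrank k (endsSubspace toFirst toLast W₀ W₁ i)) :
    ∃ W : ∀ i, Submodule k (V i), IsLinkedFamily up down W ∧ W 0 = W₀ ∧ W (Fin.last m) = W₁ ∧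
      ∀ i, finrank k (W i) = r := by
  have hlink := isLinkedFamily_endsSubspace hf hl hud hdu W₀ W₁
  have hle0 : endsSubspace toFirst toLast W₀ W₁ 0 ≤ W₀ := fun v hv => hf0 v ▸ hv.1
  have hle1 : endsSubspace toFirst toLast W₀ W₁ (Fin.last m) ≤ W₁ := fun v hv => hl0 v ▸ hv.2
  obtain ⟨W, hW, hWle, hWr⟩ : ∃ W : ∀ i, Submodule k (V i), IsLinkedFamily up down W ∧
      (∀ i, W i ≤ endsSubspace toFirst toLast W₀ W₁ i) ∧ ∀ i, finrank k (W i) = r := by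
    -- For `c = 0` the family is shrunk. Otherwise each `down i` is injective, hence so is the map
    -- to the first member, and the dimensions are at most `r` already.
    by_cases hc : c = 0
    · refine hlink.exists_finrank_eq (fun i => ?_) (fun i => ?_) (hdd hc) hr
        (le_antisymm (h0 ▸ Submodule.finrank_mono hle0) (hr 0))
        (le_antisymm (h1 ▸ Submodule.finrank_mono hle1) (hr _))
      · ext v; simp [hud, hc]
      · ext v; simp [hdu, hc]
    · refine ⟨_, hlink, fun _ => le_rfl, fun i => le_antisymm ?_ (hr i)⟩
      have hinj : Function.Injective (toFirst i) := by
        induction i using Fin.induction with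
        | zero => exact fun v w h => by rwa [hf0, hf0] at h
        | succ i ih =>
          intro v w h
          rw [hf, hf] at h
          have h2 := congrArg (up i) (ih h)
          rw [hud, hud] at h2
          exact smul_right_injective _ hc h2
      rw [← h0, (Submodule.equivMapOfInjective (toFirst i) hinj
        (endsSubspace toFirst toLast W₀ W₁ i)).finrank_eq]
      exact Submodule.finrank_mono (Submodule.map_le_iff_le_comap.2 inf_le_left)
  -- At the ends the members are contained in `W₀` and `W₁`, and the dimensions agree.
  exact ⟨W, hW, Submodule.eq_of_le_of_finrank_eq ((hWle 0).trans hle0) ((hWr 0).trans h0.symm),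
    Submodule.eq_of_le_of_finrank_eq ((hWle _).trans hle1) ((hWr _).trans h1.symm), hWr⟩

end EndsSubspace

namespace Chain

variable {X Y : Scheme.{u}} {m : ℕ} (C : Chain X m)

lemma toFirst_zero : C.toFirst 0 = 𝟙 _ := rfl

lemma toFirst_succ (i : Fin m) : C.toFirst i.succ = C.down i ≫ C.toFirst i.castSucc :=
  Fin.induction_succ (motive := fun i => C.obj i ⟶ C.obj 0) _ _ i

lemma toLast_last : C.toLast (Fin.last m) = 𝟙 _ :=
  Fin.reverseInduction_last (motive := fun i => C.obj i ⟶ C.obj (Fin.last m))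

lemma toLast_castSucc (i : Fin m) : C.toLast i.castSucc = C.up i ≫ C.toLast i.succ :=
  Fin.reverseInduction_castSucc (motive := fun i => C.obj i ⟶ C.obj (Fin.last m)) i

lemma pullback_toFirst (p : Y ⟶ X) (i : Fin (m + 1)) :
    (C.pullback p).toFirst i = (Scheme.Modules.pullback p).map (C.toFirst i) := by
  induction i using Fin.induction with
  | zero => exact ((Scheme.Modules.pullback p).map_id _).symm
  | succ i ih => rw [toFirst_succ, toFirst_succ, ih, Functor.map_comp]; rfl

lemma pullback_toLast (p : Y ⟶ X) (i : Fin (m + 1)) :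
    (C.pullback p).toLast i = (Scheme.Modules.pullback p).map (C.toLast i) := by
  induction i using Fin.reverseInduction with
  | last => rw [toLast_last, toLast_last]; exact ((Scheme.Modules.pullback p).map_id _).symm
  | cast i ih => rw [toLast_castSucc, toLast_castSucc, ih, Functor.map_comp]; rfl

end Chain

end

/-! ### The two loci in terms of fibers. -/

noncomputable section

/-- Rank-nullity, with `N` the kernel of `f` transported by `e`. The assumption `r ≤ d` ensures that
`d - r` is not truncated. -/
lemma finrank_range_le_sub_iff {K V V' W : Type*} [Field K] [AddCommGroup V] [Module K V]
    [AddCommGroup V'] [Module K V'] [AddCommGroup W] [Module K W] [FiniteDimensional K V]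
    {d r : ℕ} (hrd : r ≤ d) (hd : Module.finrank K V = d) (f : V →ₗ[K] W) (e : V ≃ₗ[K] V')
    (N : Submodule K V') (hN : ∀ v, e v ∈ N ↔ f v = 0) :
    Module.finrank K (LinearMap.range f) ≤ d - r ↔ r ≤ Module.finrank K N := by
  have h1 : N = (LinearMap.ker f).map e.toLinearMap := by
    ext v
    obtain ⟨v, rfl⟩ := e.surjective v
    rw [Submodule.mem_map_equiv, LinearEquiv.symm_apply_apply, LinearMap.mem_ker, hN]
  have h2 := LinearMap.finrank_range_add_finrank_ker f
  rw [h1, LinearEquiv.finrank_map_eq]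
  omega

section Support

variable {X : Scheme.{u}} {m : ℕ} (C : Chain X m)

lemma mem_support_linkedIdeal {F : Fin (m + 1) → X.Modules} (ι : ∀ i, F i ⟶ C.obj i) (x : X) :
    x ∈ (linkedIdeal C ι).support ↔
      (∀ i : Fin m,
        x ∈ (rankLEIdeal (ι i.castSucc ≫ C.up i ≫ cokernel.π (ι i.succ)) 0).support) ∧
      ∀ i : Fin m,
        x ∈ (rankLEIdeal (ι i.succ ≫ C.down i ≫ cokernel.π (ι i.castSucc)) 0).support := by
  rw [linkedIdeal, Scheme.IdealSheafData.support_sup, Scheme.IdealSheafData.support_iSup,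
    Scheme.IdealSheafData.support_iSup]
  simp only [← SetLike.mem_coe, TopologicalSpace.Closeds.coe_inf,
    TopologicalSpace.Closeds.coe_iInf, Set.mem_inter_iff, Set.mem_iInter]

lemma mem_support_linkedDetIdeal (d r : ℕ) {F F' : X.Modules} (ι : F ⟶ C.obj 0)
    (ι' : F' ⟶ C.obj (Fin.last m)) (x : X) :
    x ∈ (linkedDetIdeal C d r ι ι').support ↔
      ∀ i, x ∈ (rankLEIdeal (toQuotients C ι ι' i) (d - r)).support := by
  rw [linkedDetIdeal, Scheme.IdealSheafData.support_iSup]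
  simp only [← SetLike.mem_coe, TopologicalSpace.Closeds.coe_iInf, Set.mem_iInter]

end Support

section Loci

variable {S T : Scheme.{u}} {K : Type u} [Field K] {r : ℕ} {p : T ⟶ S} {q : Spec (.of K) ⟶ S}
  {x : Spec (.of K) ⟶ T}

/-- The morphism `φ'` is kept apart from the pullback of `φ` because the composites of a pulled back
chain are identified with pullbacks of composites only through a proved equality. -/
lemma IsSubbundle.map_mem_fiberSubspace_iff {G : Scheme.{u}} {E' E : S.Modules} {π : G ⟶ S}
    {F : G.Modules} {ι : F ⟶ (Scheme.Modules.pullback π).obj E} (h : IsSubbundle ι r)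
    (hE : IsFiniteLocallyFree E) (a : T ⟶ G) (ha : a ≫ π = p) (k : Spec (.of K) ⟶ G)
    (hk : x ≫ a = k) (hq : x ≫ p = q) (hkq : k ≫ π = q) (φ : E' ⟶ E)
    (φ' : (Scheme.Modules.pullback p).obj E' ⟶ (Scheme.Modules.pullback p).obj E)
    (hφ : φ' = (Scheme.Modules.pullback p).map φ) (v) :
    (fiberFunctor q).map φ (fiberPullbackEquiv x p q hq E' v) ∈ fiberSubspace ι k q hkq ↔
      (fiberFunctor x).map (φ' ≫ cokernel.π (pullbackInclusion ι a p ha)) v = 0 := by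
  rw [← fiberPullbackEquiv_naturality, h.mem_fiberSubspace_iff hE a p ha x k hk q hq hkq, hφ,
    Functor.map_comp]
  rfl

/-- The locus where a morphism maps a subbundle into another one, in terms of fibers. -/
lemma mem_support_rankLEIdeal_zero_iff {G₁ G₂ : Scheme.{u}} {E₁ E₂ : S.Modules} {π₁ : G₁ ⟶ S}
    {π₂ : G₂ ⟶ S} {F₁ : G₁.Modules} {F₂ : G₂.Modules}
    {ι₁ : F₁ ⟶ (Scheme.Modules.pullback π₁).obj E₁} {ι₂ : F₂ ⟶ (Scheme.Modules.pullback π₂).obj E₂}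
    (h₁ : IsSubbundle ι₁ r) (h₂ : IsSubbundle ι₂ r) (hE₂ : IsFiniteLocallyFree E₂) (φ : E₁ ⟶ E₂)
    (a₁ : T ⟶ G₁) (a₂ : T ⟶ G₂) (ha₁ : a₁ ≫ π₁ = p) (ha₂ : a₂ ≫ π₂ = p) (hq : x ≫ p = q)
    (k₁ : Spec (.of K) ⟶ G₁) (k₂ : Spec (.of K) ⟶ G₂) (hk₁ : x ≫ a₁ = k₁) (hk₂ : x ≫ a₂ = k₂)
    (hkq₁ : k₁ ≫ π₁ = q) (hkq₂ : k₂ ≫ π₂ = q) (y) :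
    x y ∈ (rankLEIdeal (pullbackInclusion ι₁ a₁ p ha₁ ≫ (Scheme.Modules.pullback p).map φ ≫
        cokernel.π (pullbackInclusion ι₂ a₂ p ha₂)) 0).support ↔
      (fiberSubspace ι₁ k₁ q hkq₁).map ((fiberFunctor q).map φ).hom ≤
        fiberSubspace ι₂ k₂ q hkq₂ := by
  have hQ := h₂.cokernel_pullbackInclusion a₂ p ha₂
  have := hQ.finite_fiber x
  rw [mem_support_rankLEIdeal_iff x (h₁.isVectorBundle.isFiniteLocallyFree.pullback a₁) hQ,
    Nat.le_zero, Submodule.finrank_eq_zero, LinearMap.range_eq_bot, Submodule.map_le_iff_le_comap]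
  have key : ∀ w, fiberPullbackEquiv x p q hq E₁ w ∈
      (fiberSubspace ι₂ k₂ q hkq₂).comap ((fiberFunctor q).map φ).hom ↔
      (fiberFunctor x).map (cokernel.π (pullbackInclusion ι₂ a₂ p ha₂))
        ((fiberFunctor x).map ((Scheme.Modules.pullback p).map φ) w) = 0 := fun w => by
    rw [← h₂.mem_fiberSubspace_iff hE₂ a₂ p ha₂ x k₂ hk₂ q hq hkq₂, fiberPullbackEquiv_naturality]
    rfl
  constructor
  · intro h v hv
    obtain ⟨w, rfl⟩ := (fiberPullbackEquiv x p q hq E₁).surjective v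
    rw [map_range_pullbackInclusion ι₁ a₁ p ha₁ x k₁ hk₁ q hq hkq₁] at hv
    obtain ⟨w, rfl⟩ := hv
    refine (key _).2 ?_
    have := LinearMap.congr_fun h w
    simp only [Functor.map_comp] at this
    exact this
  · intro h
    ext w
    have := (key _).1 (h ((map_range_pullbackInclusion ι₁ a₁ p ha₁ x k₁ hk₁ q hq hkq₁ _).2 ⟨w, rfl⟩))
    simp only [Functor.map_comp]
    exact this

variable {m : ℕ} (C : Chain S m)

/-- The fibers of a chain at a field-valued point. -/
abbrev Chain.fiber (q : Spec (.of K) ⟶ S) (i : Fin (m + 1)) : ModuleCat.{u} K :=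
  (fiberFunctor q).obj (C.obj i)

/-- The maps `f_i` on the fibers of a chain. -/
abbrev Chain.fiberUp (q : Spec (.of K) ⟶ S) (i : Fin m) :
    C.fiber q i.castSucc →ₗ[K] C.fiber q i.succ :=
  ((fiberFunctor q).map (C.up i)).hom

/-- The maps `f^i` on the fibers of a chain. -/
abbrev Chain.fiberDown (q : Spec (.of K) ⟶ S) (i : Fin m) :
    C.fiber q i.succ →ₗ[K] C.fiber q i.castSucc :=
  ((fiberFunctor q).map (C.down i)).hom

variable {G : Fin (m + 1) → Scheme.{u}} {π : ∀ i, G i ⟶ S} {𝒰 : ∀ i, (G i).Modules}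
  {ι : ∀ i, 𝒰 i ⟶ (Scheme.Modules.pullback (π i)).obj (C.obj i)}

/-- The linked locus in terms of fibers. -/
theorem mem_support_linkedIdeal_iff (hC : ∀ i, IsFiniteLocallyFree (C.obj i))
    (hι : ∀ i, IsSubbundle (ι i) r) (a : ∀ i, T ⟶ G i) (ha : ∀ i, a i ≫ π i = p)
    (hq : x ≫ p = q) (k : ∀ i, Spec (.of K) ⟶ G i) (hk : ∀ i, x ≫ a i = k i)
    (hkq : ∀ i, k i ≫ π i = q) (y) :
    x y ∈ (linkedIdeal (C.pullback p) fun i => pullbackInclusion (ι i) (a i) p (ha i)).support ↔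
      IsLinkedFamily (C.fiberUp q) (C.fiberDown q)
        fun i => fiberSubspace (ι i) (k i) q (hkq i) := by
  refine (mem_support_linkedIdeal (C.pullback p) _ _).trans
    (and_congr (forall_congr' fun i => mem_support_rankLEIdeal_zero_iff
    (hι i.castSucc) (hι i.succ) (hC i.succ) (C.up i) (a i.castSucc) (a i.succ) (ha _) (ha _) hq
    (k i.castSucc) (k i.succ) (hk _) (hk _) (hkq _) (hkq _) y)
    (forall_congr' fun i => mem_support_rankLEIdeal_zero_iff
    (hι i.succ) (hι i.castSucc) (hC i.castSucc) (C.down i) (a i.succ) (a i.castSucc) (ha _) (ha _)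
    hq (k i.succ) (k i.castSucc) (hk _) (hk _) (hkq _) (hkq _) y))

lemma biprod_lift_fiber_eq_zero_iff {E H H' : T.Modules} (φ : E ⟶ H) (φ' : E ⟶ H') (v) :
    (fiberFunctor x).map (biprod.lift φ φ') v = 0 ↔
      (fiberFunctor x).map φ v = 0 ∧ (fiberFunctor x).map φ' v = 0 := by
  have h1 : (fiberFunctor x).map (biprod.fst : H ⊞ H' ⟶ H)
      ((fiberFunctor x).map (biprod.lift φ φ') v) = (fiberFunctor x).map φ v := by
    rw [← ModuleCat.comp_apply, ← Functor.map_comp, biprod.lift_fst]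
  have h2 : (fiberFunctor x).map (biprod.snd : H ⊞ H' ⟶ H')
      ((fiberFunctor x).map (biprod.lift φ φ') v) = (fiberFunctor x).map φ' v := by
    rw [← ModuleCat.comp_apply, ← Functor.map_comp, biprod.lift_snd]
  constructor
  · intro h
    rw [← h1, ← h2, h, map_zero, map_zero]
    exact ⟨rfl, rfl⟩
  · rintro ⟨h, h'⟩
    rw [biprod.lift_eq, Functor.map_add, Functor.map_comp, Functor.map_comp]
    change (fiberFunctor x).map biprod.inl ((fiberFunctor x).map φ v) +
      (fiberFunctor x).map biprod.inr ((fiberFunctor x).map φ' v) = 0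
    rw [h, h', map_zero, map_zero, add_zero]

/-- The linked determinantal locus in terms of fibers. -/
theorem mem_support_linkedDetIdeal_iff {d : ℕ} (hrd : r ≤ d) (hC : ∀ i, IsVectorBundle (C.obj i) d)
    (h₀ : IsSubbundle (ι 0) r) (h₁ : IsSubbundle (ι (Fin.last m)) r)
    (a₀ : T ⟶ G 0) (a₁ : T ⟶ G (Fin.last m)) (ha₀ : a₀ ≫ π 0 = p) (ha₁ : a₁ ≫ π (Fin.last m) = p)
    (hq : x ≫ p = q) (k₀ : Spec (.of K) ⟶ G 0) (k₁ : Spec (.of K) ⟶ G (Fin.last m))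
    (hk₀ : x ≫ a₀ = k₀) (hk₁ : x ≫ a₁ = k₁) (hkq₀ : k₀ ≫ π 0 = q)
    (hkq₁ : k₁ ≫ π (Fin.last m) = q) (y) :
    x y ∈ (linkedDetIdeal (C.pullback p) d r (pullbackInclusion (ι 0) a₀ p ha₀)
        (pullbackInclusion (ι (Fin.last m)) a₁ p ha₁)).support ↔
      ∀ i, r ≤ Module.finrank K (endsSubspace (V := fun i => C.fiber q i)
        (fun i => ((fiberFunctor q).map (C.toFirst i)).hom)
        (fun i => ((fiberFunctor q).map (C.toLast i)).hom)
        (fiberSubspace (ι 0) k₀ q hkq₀) (fiberSubspace (ι (Fin.last m)) k₁ q hkq₁) i) := by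
  refine (mem_support_linkedDetIdeal (C.pullback p) d r _ _ _).trans
    (forall_congr' fun i => ?_)
  have hE := (hC i).isFiniteLocallyFree.pullback p
  have := hE.finite_fiber x
  refine (mem_support_rankLEIdeal_iff x hE ((h₀.cokernel_pullbackInclusion a₀ p ha₀).biprod
    (h₁.cokernel_pullbackInclusion a₁ p ha₁)) _ _ y).trans ?_
  -- The kernel on the fiber at `x` corresponds to the subspace cut out at `q` by the two ends.
  refine finrank_range_le_sub_iff hrd (((hC i).pullback p).finrank_fiber x) _
    (fiberPullbackEquiv x p q hq (C.obj i)) _ fun v => ?_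
  refine Iff.trans ?_ (biprod_lift_fiber_eq_zero_iff _ _ v).symm
  exact and_congr
    (h₀.map_mem_fiberSubspace_iff (hC 0).isFiniteLocallyFree a₀ ha₀ k₀ hk₀ hq hkq₀ _ _
      (C.pullback_toFirst p i) v)
    (h₁.map_mem_fiberSubspace_iff (hC _).isFiniteLocallyFree a₁ ha₁ k₁ hk₁ hq hkq₁ _ _
      (C.pullback_toLast p i) v)

end Loci

end

end LinkedDet

/-! ### Comparison of the linked Grassmannian with the determinantal locus. -/

namespace LinkedDet

section Comparison

variable {S₀ : Scheme.{u}} {m d r : ℕ} {s : Γ(S₀, ⊤)} {C : Chain S₀ m}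
  {G : Fin (m + 1) → Scheme.{u}} {π : ∀ i, G i ⟶ S₀} {𝒰 : ∀ i, (G i).Modules}
  {ι : ∀ i, 𝒰 i ⟶ (Scheme.Modules.pullback (π i)).obj (C.obj i)} {K : Type u} [Field K]

lemma projection_fst : projection π ≫ pullback.fst (π 0) (π (Fin.last m)) = WidePullback.π π 0 :=
  pullback.lift_fst _ _ _

lemma projection_snd :
    projection π ≫ pullback.snd (π 0) (π (Fin.last m)) = WidePullback.π π (Fin.last m) :=
  pullback.lift_snd _ _ _

lemma projection_endsBase : projection π ≫ endsBase π = WidePullback.base π := by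
  rw [endsBase, ← Category.assoc, projection_fst, WidePullback.π_arrow]

/-- A field-valued point exhibits an `r`-dimensional subspace of a `d`-dimensional fiber. -/
lemma IsSubbundle.le_rank (hC : ∀ i, IsVectorBundle (C.obj i) d) (h : IsSubbundle (ι 0) r)
    (k : Spec (.of K) ⟶ G 0) : r ≤ d := by
  have := (hC 0).isFiniteLocallyFree.finite_fiber (k ≫ π 0)
  rw [← h.finrank_fiberSubspace (hC 0).isFiniteLocallyFree k _ rfl,
    ← (hC 0).finrank_fiber (k ≫ π 0)]
  exact Submodule.finrank_le _

lemma Chain.fiber_toFirst_zero (q : Spec (.of K) ⟶ S₀) (v : C.fiber q 0) :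
    (fiberFunctor q).map (C.toFirst 0) v = v := by
  rw [C.toFirst_zero, CategoryTheory.Functor.map_id]
  rfl

lemma Chain.fiber_toFirst_succ (q : Spec (.of K) ⟶ S₀) (i : Fin m) (v : C.fiber q i.succ) :
    (fiberFunctor q).map (C.toFirst i.succ) v =
      (fiberFunctor q).map (C.toFirst i.castSucc) (C.fiberDown q i v) := by
  rw [C.toFirst_succ, Functor.map_comp]
  rfl

lemma Chain.fiber_toLast_last (q : Spec (.of K) ⟶ S₀) (v : C.fiber q (Fin.last m)) :
    (fiberFunctor q).map (C.toLast (Fin.last m)) v = v := by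
  rw [C.toLast_last, CategoryTheory.Functor.map_id]
  rfl

lemma Chain.fiber_toLast_castSucc (q : Spec (.of K) ⟶ S₀) (i : Fin m)
    (v : C.fiber q i.castSucc) :
    (fiberFunctor q).map (C.toLast i.castSucc) v =
      (fiberFunctor q).map (C.toLast i.succ) (C.fiberUp q i v) := by
  rw [C.toLast_castSucc, Functor.map_comp]
  rfl

/-- The image of a point of the linked Grassmannian lies in the linked determinantal locus. -/
lemma projection_mem_support (hC : IsLinkedChain C d s)
    (hι : ∀ i, IsSubbundle (ι i) r) (z : totalProduct π)
    (hz : z ∈ (linkedGrassmannianIdeal C π ι).support) :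
    projection π z ∈ (universalLinkedDetIdeal C d r π ι).support := by
  have hE := fun i => (hC.isVectorBundle i).isFiniteLocallyFree
  let h : Spec (.of ((totalProduct π).residueField z)) ⟶ totalProduct π :=
    (totalProduct π).fromSpecResidueField z
  have hhz : h default = z := Scheme.fromSpecResidueField_apply _ _
  let q := h ≫ WidePullback.base π
  let k := fun i => h ≫ WidePullback.π π i
  have hkq : ∀ i, k i ≫ π i = q := fun i => by
    rw [Category.assoc, WidePullback.π_arrow]
  rw [← hhz] at hz ⊢
  have hlink := (mem_support_linkedIdeal_iff C hE hι (WidePullback.π π)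
    (fun i => WidePullback.π_arrow π i) rfl k (fun i => rfl) hkq default).1 hz
  refine (mem_support_linkedDetIdeal_iff C (x := h ≫ projection π) (p := endsBase π) (q := q)
    ((hι 0).le_rank hC.isVectorBundle (k 0)) hC.isVectorBundle
    (hι 0) (hι _) _ _ rfl pullback.condition.symm
    (by rw [Category.assoc, projection_endsBase])
    (k 0) (k _) (by rw [Category.assoc, projection_fst]) (by rw [Category.assoc, projection_snd])
    (hkq 0) (hkq _) default).2 fun i => ?_
  have := (hE i).finite_fiber q
  -- The `i`-th member of the linked tuple has dimension `r` and lies in the subspace cut out by the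
  -- ends.
  rw [← (hι i).finrank_fiberSubspace (hE i) (k i) q (hkq i)]
  exact Submodule.finrank_mono (hlink.le_endsSubspace (fun v => C.fiber_toFirst_zero q v)
    (fun i v => C.fiber_toFirst_succ q i v) (fun v => C.fiber_toLast_last q v)
    (fun i v => C.fiber_toLast_castSucc q i v) i)

/-- Every point of the linked determinantal locus is the image of a point of the linked
Grassmannian. -/
lemma exists_projection_eq (hC : IsLinkedChain C d s)
    (hG : ∀ i, IsGrassmannian r (C.obj i) (π i) (ι i)) (x : endsProduct π)
    (hx : x ∈ (universalLinkedDetIdeal C d r π ι).support) :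
    ∃ z ∈ (linkedGrassmannianIdeal C π ι).support, projection π z = x := by
  have hE := fun i => (hC.isVectorBundle i).isFiniteLocallyFree
  have hι := fun i => (hG i).isSubbundle
  let g : Spec (.of ((endsProduct π).residueField x)) ⟶ endsProduct π :=
    (endsProduct π).fromSpecResidueField x
  have hgx : g default = x := Scheme.fromSpecResidueField_apply _ _
  let q := g ≫ endsBase π
  let k₀ := g ≫ pullback.fst (π 0) (π (Fin.last m))
  let k₁ := g ≫ pullback.snd (π 0) (π (Fin.last m))
  have hkq₀ : k₀ ≫ π 0 = q := Category.assoc _ _ _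
  have hkq₁ : k₁ ≫ π (Fin.last m) = q := by
    rw [Category.assoc, ← pullback.condition]; rfl
  rw [← hgx] at hx
  have hr := (mem_support_linkedDetIdeal_iff C
    ((hι 0).le_rank hC.isVectorBundle k₀) hC.isVectorBundle
    (hι 0) (hι _) _ _ rfl pullback.condition.symm rfl k₀ k₁ rfl rfl hkq₀ hkq₁ default).1 hx
  obtain ⟨c, hc, hsmul⟩ := exists_fiberFunctor_map_eq_smul q default s
  have hfin := fun i => (hE i).finite_fiber q
  obtain ⟨W, hW, hW0, hW1, hWr⟩ := exists_isLinkedFamily (V := fun i => C.fiber q i)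
    (up := C.fiberUp q) (down := C.fiberDown q)
    (fun v => C.fiber_toFirst_zero q v)
    (fun i v => C.fiber_toFirst_succ q i v) (fun v => C.fiber_toLast_last q v)
    (fun i v => C.fiber_toLast_castSucc q i v)
    (fun i v => hsmul _ _ (hE _) (hC.down_up i) v)
    (fun i v => hsmul _ _ (hE _) (hC.up_down i) v)
    -- The intersection condition is given over the residue field of the image point in `S₀`, while
    -- the fibers here are over the residue field of `x`.
    (fun h a ha v hv => by
      have h3 := hC.range_down_inf_ker_down _ (hc.1 h) a ⟨a.1 + 1, ha⟩ rfl
      rw [eqToHom_refl, Category.comp_id] at h3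
      exact fiberFunctor_map_eq_zero_of_range_inf_ker (hE _) (hE _) (hE _) _ _ q default h3 v hv)
    ((hι 0).finrank_fiberSubspace (hE 0) k₀ q hkq₀)
    ((hι _).finrank_fiberSubspace (hE _) k₁ q hkq₁) hr
  choose k hkq hk using fun i => (hG i).exists_fiberSubspace_eq (hE i) q (W i) (hWr i)
  -- The end members of `W` are the given subspaces, so the end points agree with the coordinates of
  -- `g`. This makes the new point of the product lie over `x`.
  have h0 : k 0 = k₀ := (hG 0).eq_of_fiberSubspace_eq (hE 0) _ _ q (hkq 0) hkq₀
    ((hk 0).trans hW0)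
  have h1 : k (Fin.last m) = k₁ := (hG _).eq_of_fiberSubspace_eq (hE _) _ _ q (hkq _) hkq₁
    ((hk _).trans hW1)
  let h : Spec (.of ((endsProduct π).residueField x)) ⟶ totalProduct π :=
    WidePullback.lift q k hkq
  refine ⟨h default, ?_, ?_⟩
  · refine (mem_support_linkedIdeal_iff C hE hι (WidePullback.π π)
      (fun i => WidePullback.π_arrow π i) (WidePullback.lift_base _ _ _ _) k
      (fun i => WidePullback.lift_π _ _ _ _ _) hkq default).2 ?_
    simpa only [hk] using hW
  · have hcomp : h ≫ projection π = g := by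
      refine pullback.hom_ext ?_ ?_
      · rw [Category.assoc, projection_fst]
        exact (WidePullback.lift_π _ _ _ _ _).trans h0
      · rw [Category.assoc, projection_snd]
        exact (WidePullback.lift_π _ _ _ _ _).trans h1
    have hpt : projection π (h default) = g default :=
      congrArg (fun f : Spec (.of ((endsProduct π).residueField x)) ⟶ endsProduct π =>
        f default) hcomp
    exact hpt.trans hgx

end Comparison

end LinkedDet

theorem propositionA4 (S₀ : Scheme.{u}) (m d r : ℕ) (hd : 0 < d) (hr : 0 < r) (s : Γ(S₀, ⊤))
    (C : LinkedDet.Chain S₀ m) (hC : LinkedDet.IsLinkedChain C d s)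
    (G : Fin (m + 1) → Scheme.{u}) (π : ∀ i, G i ⟶ S₀) (𝒰 : ∀ i, (G i).Modules)
    (ι : ∀ i, 𝒰 i ⟶ (Scheme.Modules.pullback (π i)).obj (C.obj i))
    (hG : ∀ i, LinkedDet.IsGrassmannian r (C.obj i) (π i) (ι i)) :
    Set.range (LinkedDet.universalLinkedDetIdeal C d r π ι).subschemeι =
      Set.range ((LinkedDet.linkedGrassmannianIdeal C π ι).subschemeι ≫
        LinkedDet.projection π) := by
  have hcomp : Set.range ((LinkedDet.linkedGrassmannianIdeal C π ι).subschemeι ≫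
      LinkedDet.projection π) =
      LinkedDet.projection π '' Set.range (LinkedDet.linkedGrassmannianIdeal C π ι).subschemeι := by
    rw [← Set.range_comp]
    rfl
  rw [hcomp, Scheme.IdealSheafData.range_subschemeι, Scheme.IdealSheafData.range_subschemeι]
  refine Set.Subset.antisymm (fun x hx => LinkedDet.exists_projection_eq hC hG x hx) ?_
  rintro _ ⟨z, hz, rfl⟩
  exact LinkedDet.projection_mem_support hC (fun i => (hG i).isSubbundle) z hz
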